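/- Let $F$ be a non-archimedean local field with ring of integers $\mathcal O_F$, maximal ideal $\mathfrak m_F$ and finite residue field of characteristic $p$. Let $G=\mathrm{GL}_2(F)$ and let $X$ be the Bruhat–Tits tree of $\mathrm{PGL}_2(F)$: its vertices are the homothety classes of $\mathcal O_F$-lattices in $F^2$, and two vertices are adjacent if they are represented by lattices $L,M$ with $\mathfrak m_FL\subsetneq M\subsetneq L$. Let $d$ be the distance on vertices, let $\mathrm{Aut}(X)$ be the group of permutations of the vertices preserving $d$, and put $Z^{(m)}(x)=\{y : d(x,y)\le m\}$ and $Z^{(m)}(\tau)=Z^{(m)}(x)\cup Z^{(m)}(y)$ for a vertex $x$ or an edge $\tau=\{x,y\}$ and $m\ge 0$. For a vertex $x$ let $K_x\subset G$ be the maximal compact subgroup fixing $x$, let $U_x^{(1)}$ be its maximal normal pro-$p$-subgroup, and for $e\ge 1$ put $U_x^{(e)}=\bigcap_{d(x,y)\le e-1}U_y^{(1)}$. For an edge $\tau=\{x,y\}$ let $U_\tau^{(e)}\subset G$ be the subgroup generated by $U_x^{(e)}$ and $U_y^{(e)}$. Let $\widehat G^{(e)}$ (respectively $\widehat U_\tau^{(e)}$)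 be the group of all $g\in\mathrm{Aut}(X)$ such that for every edge $\mu$ there is $g'\in G$ (respectively $g'\in U_\tau^{(e)}$) with $g=g'$ on $Z^{(e)}(\mu)$. The action on $X$ gives a homomorphism $G\to\widehat G^{(e)}$ mapping $U_\tau^{(e)}$ into $\widehat U_\tau^{(e)}$. Let $\mathfrak o$ be a complete discrete valuation ring with residue field $k$ of characteristic $p$, and let $\Lambda$ be an Artinian local $\mathfrak o$-algebra with residue field $k$. Fix $e\ge1$ and an edge $\sigma$ of $X$. Let $\widehat{\mathfrak R}_0^{(e)}(\Lambda)$ be the category of representations $V$ of $\widehat G^{(e)}$ on $\Lambda$-modules which are generated by $V^{\widehat U_\sigma^{(e)}}$ as $\widehat G^{(e)}$-representations and on which $\widehat U_\sigma^{(e)}$ acts smoothly, i.e. for each $v\in V$ there is $m\ge 0$ such that $v$ is fixed by all $u\in\widehat U_\sigma^{(e)}$ fixing $Z^{(m)}(\sigma)$ pointwise. Let $\mathcal H_\Lambda(G,U_\sigma^{(e)})=\mathrm{End}_G(\mathcal J)$, where $\mathcal J$ is the $G$-representation, by right translation, on the compactly supported functions $U_\sigma^{(e)}\backslash G\to\Lambda$.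 For a representation $V$ of $G$ over $\Lambda$ this algebra acts naturally from the right on $V^{U_\sigma^{(e)}}\cong\mathrm{Hom}_G(\mathcal J,V)$ by precomposition; explicitly, if $U_\sigma^{(e)}gU_\sigma^{(e)}=\coprod_jU_\sigma^{(e)}g_j$, then the endomorphism sending the characteristic function of $U_\sigma^{(e)}$ to that of $U_\sigma^{(e)}gU_\sigma^{(e)}$ acts by $v\mapsto\sum_jg_j^{-1}v$. **Proposition.** Let $V\in\widehat{\mathfrak R}_0^{(e)}(\Lambda)$, regarded as a representation of $G$ through $G\to\widehat G^{(e)}$. Then the right action of $\mathcal H_\Lambda(G,U_\sigma^{(e)})$ on $V^{U_\sigma^{(e)}}$ preserves the submodule $V^{\widehat U_\sigma^{(e)}}\subset V^{U_\sigma^{(e)}}$. Consequently $V^{\widehat U_\sigma^{(e)}}$ is a right $\mathcal H_\Lambda(G,U_\sigma^{(e)})$-module under the restricted action, compatibly with its $\Lambda$-module structure. -/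

import Mathlib

open scoped ValuativeRel Pointwise

/-! ### The Hecke algebra of a subgroup and its right action on invariants -/

namespace HeckeAction

section Induction

variable (Λ : Type*) [CommRing Λ] {G : Type*} [Group G] (U : Subgroup G)

/-- The set `U \ G` of right cosets `U x`. -/
abbrev RightCosets : Type _ := Quotient (QuotientGroup.rightRel U)

/-- The right coset `U x`. -/
def coset (x : G) : RightCosets U := Quotient.mk (QuotientGroup.rightRel U) x

variable {U} in
theorem coset_eq_iff {x y : G} : coset U x = coset U y ↔ y * x⁻¹ ∈ U := by
  unfold coset
  rw [Quotient.eq]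
  exact QuotientGroup.rightRel_apply

/-- The action of `G` on `U \ G` given by `g • U x = U x g⁻¹`. -/
def shift (g : G) : RightCosets U → RightCosets U :=
  Quotient.lift (fun x => coset U (x * g⁻¹)) (by
    intro a b h
    have h' : b * a⁻¹ ∈ U := QuotientGroup.rightRel_apply.1 h
    rw [coset_eq_iff]
    simpa [mul_assoc] using h')

@[simp] theorem shift_coset (g x : G) : shift U g (coset U x) = coset U (x * g⁻¹) := rfl

theorem shift_one : shift U (1 : G) = id := by
  funext t
  induction t using Quotient.inductionOn with
  | h x => exact (shift_coset U 1 x).trans (by simp [coset])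

theorem shift_mul (g h : G) : shift U (g * h) = shift U g ∘ shift U h := by
  funext t
  induction t using Quotient.inductionOn with
  | h x =>
    change coset U (x * (g * h)⁻¹) = coset U (x * h⁻¹ * g⁻¹)
    simp [mul_assoc]

/-- The `Λ`-module of finitely supported functions on `U \ G`. If `U` is an open subgroup, so that
`U \ G` is discrete, these are the compactly supported functions on `U \ G`, i.e. this is the
compact induction of the trivial representation. -/
abbrev CInd : Type _ := RightCosets U →₀ Λ

/-- The representation of `G` on the functions on `U \ G` by right translation,
`(g f)(t) = f(t g)`. -/
noncomputable def cIndRep : Representation Λ G (CInd Λ U) where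
  toFun g := Finsupp.lmapDomain Λ Λ (shift U g)
  map_one' := by rw [shift_one, Finsupp.lmapDomain_id]; rfl
  map_mul' g h := by rw [shift_mul, Finsupp.lmapDomain_comp]; rfl

theorem cIndRep_single (g x : G) (a : Λ) :
    cIndRep Λ U g (Finsupp.single (coset U x) a) = Finsupp.single (coset U (x * g⁻¹)) a := by
  simp [cIndRep, Finsupp.lmapDomain_apply, Finsupp.mapDomain_single]

theorem cIndRep_apply (g x : G) (f : CInd Λ U) :
    cIndRep Λ U g f (coset U x) = f (coset U (x * g)) := by
  have hinj : Function.Injective (shift U g) := by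
    refine Function.LeftInverse.injective (g := shift U g⁻¹) fun t => ?_
    have := congrFun (shift_mul U g⁻¹ g) t
    rw [inv_mul_cancel, shift_one] at this
    exact this.symm
  have h : coset U x = shift U g (coset U (x * g)) := by simp
  rw [h]
  exact Finsupp.mapDomain_apply hinj f _

/-- The Hecke algebra `End_G(ind_U^G 1)`: the `Λ`-algebra, under composition, of the `Λ`-linear
endomorphisms of `CInd Λ U` commuting with the action of `G`. -/
noncomputable abbrev Hecke : Subalgebra Λ (Module.End Λ (CInd Λ U)) :=
  Subalgebra.centralizer Λ (Set.range (cIndRep Λ U))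

variable {Λ U}

theorem Hecke.comm (T : Hecke Λ U) (g : G) (f : CInd Λ U) :
    (T : Module.End Λ (CInd Λ U)) (cIndRep Λ U g f) =
      cIndRep Λ U g ((T : Module.End Λ (CInd Λ U)) f) := by
  have h := (Subalgebra.mem_centralizer_iff Λ).1 T.2 (cIndRep Λ U g) ⟨g, rfl⟩
  exact (LinearMap.congr_fun h f).symm

variable (Λ U) in
/-- The characteristic function of the trivial coset `U`. -/
noncomputable def charU : CInd Λ U := Finsupp.single (coset U 1) 1

end Induction

section Action

variable {Λ : Type*} [CommRing Λ] {G : Type*} [Group G]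
  {V : Type*} [AddCommGroup V] [Module Λ V]

/-- The submodule `V^U` of vectors fixed by the subgroup `U`. -/
noncomputable def fixedVectors (ρ : Representation Λ G V) (U : Subgroup G) : Submodule Λ V :=
  Representation.invariants (ρ.comp U.subtype)

theorem mem_fixedVectors {ρ : Representation Λ G V} {U : Subgroup G} {v : V} :
    v ∈ fixedVectors ρ U ↔ ∀ u ∈ U, ρ u v = v := by
  simp [fixedVectors, Representation.mem_invariants]

variable (ρ : Representation Λ G V) (U : Subgroup G)

/-- For `v ∈ V^U`, the map `U \ G → V`, `U x ↦ x⁻¹ v`. -/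
def cosetVec (v : fixedVectors ρ U) : RightCosets U → V :=
  Quotient.lift (fun x => ρ x⁻¹ (v : V)) (by
    intro a b h
    have h' : b * a⁻¹ ∈ U := QuotientGroup.rightRel_apply.1 h
    have h2 := mem_fixedVectors.1 v.2 _ (U.inv_mem h')
    have h3 : b⁻¹ = a⁻¹ * (b * a⁻¹)⁻¹ := by group
    have h4 : b⁻¹ * (b * a⁻¹) = a⁻¹ := by group
    calc ρ a⁻¹ (v : V) = ρ a⁻¹ (ρ (b * a⁻¹)⁻¹ (v : V)) := by rw [h2]
      _ = ρ b⁻¹ (v : V) := by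
        rw [← Module.End.mul_apply, ← map_mul]
        congr 2
        group)

@[simp] theorem cosetVec_coset (v : fixedVectors ρ U) (x : G) :
    cosetVec ρ U v (coset U x) = ρ x⁻¹ (v : V) := rfl

/-- The `G`-equivariant map `ind_U^G 1 → V` corresponding to `v ∈ V^U` by Frobenius reciprocity,
i.e. sending the characteristic function of `U` to `v`:
`f ↦ ∑_{t ∈ U \ G} f(t) t⁻¹ v`. -/
noncomputable def frob (v : fixedVectors ρ U) : CInd Λ U →ₗ[Λ] V :=
  Finsupp.linearCombination Λ (cosetVec ρ U v)

theorem frob_single (v : fixedVectors ρ U) (x : G) (a : Λ) :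
    frob ρ U v (Finsupp.single (coset U x) a) = a • ρ x⁻¹ (v : V) := by
  simp [frob]

theorem frob_charU (v : fixedVectors ρ U) : frob ρ U v (charU Λ U) = v := by
  rw [charU, frob_single]; simp

/-- Two linear maps agreeing on the characteristic functions of all right cosets are equal. -/
theorem cInd_ext {W : Type*} [AddCommGroup W] [Module Λ W] {φ ψ : CInd Λ U →ₗ[Λ] W}
    (h : ∀ x : G, φ (Finsupp.single (coset U x) 1) = ψ (Finsupp.single (coset U x) 1)) :
    φ = ψ := by
  refine Finsupp.lhom_ext' fun t => LinearMap.ext_ring ?_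
  induction t using Quotient.inductionOn with
  | h x => exact h x

theorem frob_cIndRep (v : fixedVectors ρ U) (g : G) (f : CInd Λ U) :
    frob ρ U v (cIndRep Λ U g f) = ρ g (frob ρ U v f) := by
  have : (frob ρ U v).comp (cIndRep Λ U g) = (ρ g).comp (frob ρ U v) := by
    refine cInd_ext U fun x => ?_
    simp only [LinearMap.comp_apply, cIndRep_single, frob_single, one_smul, mul_inv_rev, inv_inv,
      map_mul, Module.End.mul_apply]
  exact LinearMap.congr_fun this f

/-- The right action of the Hecke algebra on `V^U ≅ Hom_G(ind_U^G 1, V)` by precomposition: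
`v · T` is the image of the characteristic function of `U` under
`T : ind_U^G 1 → ind_U^G 1` followed by the map `ind_U^G 1 → V` corresponding to `v`. -/
noncomputable def heckeAct (v : fixedVectors ρ U) (T : Hecke Λ U) : fixedVectors ρ U :=
  ⟨frob ρ U v ((T : Module.End Λ (CInd Λ U)) (charU Λ U)), by
    rw [mem_fixedVectors]
    intro u hu
    rw [← frob_cIndRep, ← Hecke.comm]
    congr 2
    rw [charU, cIndRep_single, coset_eq_iff.2 (show (1 : G) * (1 * u⁻¹)⁻¹ ∈ U by simpa using hu)]⟩

theorem frob_heckeAct (v : fixedVectors ρ U) (T : Hecke Λ U) (f : CInd Λ U) :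
    frob ρ U (heckeAct ρ U v T) f = frob ρ U v ((T : Module.End Λ (CInd Λ U)) f) := by
  have : frob ρ U (heckeAct ρ U v T) =
      (frob ρ U v).comp (T : Module.End Λ (CInd Λ U)) := by
    refine cInd_ext U fun x => ?_
    have hx : Finsupp.single (coset U x) (1 : Λ) = cIndRep Λ U x⁻¹ (charU Λ U) := by
      rw [charU, cIndRep_single]; simp
    rw [hx, frob_cIndRep, frob_charU, LinearMap.comp_apply, Hecke.comm, frob_cIndRep]
    rfl
  exact LinearMap.congr_fun this f

theorem frob_add (v w : fixedVectors ρ U) : frob ρ U (v + w) = frob ρ U v + frob ρ U w :=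
  cInd_ext U fun x => by simp [frob_single]

theorem frob_zero : frob ρ U (0 : fixedVectors ρ U) = 0 :=
  cInd_ext U fun x => by simp [frob_single]

theorem frob_smul (a : Λ) (v : fixedVectors ρ U) : frob ρ U (a • v) = a • frob ρ U v :=
  cInd_ext U fun x => by simp [frob_single]

/-- The right Hecke module structure on `V^U`: a right module is a left module over the opposite
ring, and `op T • v` is `v · T`. -/
noncomputable instance heckeModule : Module (Hecke Λ U)ᵐᵒᵖ (fixedVectors ρ U) where
  smul T v := heckeAct ρ U v T.unop
  one_smul v := Subtype.ext (frob_charU ρ U v)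
  mul_smul S T v := Subtype.ext (frob_heckeAct ρ U v T.unop _).symm
  smul_zero T := Subtype.ext (by
    change frob ρ U 0 _ = _
    rw [frob_zero]; rfl)
  smul_add T v w := Subtype.ext (by
    change frob ρ U (v + w) _ = _
    rw [frob_add]; rfl)
  add_smul S T v := Subtype.ext (map_add (frob ρ U v) _ _)
  zero_smul v := Subtype.ext (map_zero (frob ρ U v))

theorem op_smul_eq (v : fixedVectors ρ U) (T : Hecke Λ U) :
    MulOpposite.op T • v = heckeAct ρ U v T := rfl

/-- The formula for the action of a double coset `U g U`, written as a disjoint union of right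
cosets `U g_j`: the endomorphism attached to it sends the characteristic function of `U` to that of
`U g U`, and `v · U g U = ∑_j g_j⁻¹ v`. -/
theorem op_smul_of_eq_sum {ι : Type*} (s : Finset ι) (g : ι → G) (T : Hecke Λ U)
    (hT : (T : Module.End Λ (CInd Λ U)) (charU Λ U) =
      ∑ j ∈ s, Finsupp.single (coset U (g j)) 1) (v : fixedVectors ρ U) :
    ((MulOpposite.op T • v : fixedVectors ρ U) : V) = ∑ j ∈ s, ρ (g j)⁻¹ (v : V) := by
  change frob ρ U v _ = _
  rw [MulOpposite.unop_op, hT, map_sum]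
  simp [frob_single]

end Action

end HeckeAction

/-! ### The Bruhat-Tits tree of `PGL₂` over a local field -/

namespace BTTree

section Tree

variable (F : Type*) [Field F] [ValuativeRel F]

/-- The `𝒪`-lattices in `F²`. -/
@[ext]
structure Lattice where
  /-- the underlying submodule -/
  toSubmodule : Submodule 𝒪[F] (Fin 2 → F)
  isLattice : toSubmodule.IsLattice F

variable {F}

theorem isLattice_smul (g : GL (Fin 2) F) {L : Submodule 𝒪[F] (Fin 2 → F)} (hL : L.IsLattice F) :
    (g • L).IsLattice F := by
  refine ⟨hL.fg.map _, ?_⟩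
  have h : ((g • L : Submodule 𝒪[F] (Fin 2 → F)) : Set (Fin 2 → F)) =
      (DistribSMul.toLinearMap F (Fin 2 → F) g) '' (L : Set (Fin 2 → F)) := rfl
  rw [h, Submodule.span_image, hL.span_eq_top, Submodule.map_top, LinearMap.range_eq_top]
  exact MulAction.surjective g

/-- `GL₂(F)` acts on the lattices through its linear action on `F²`. -/
noncomputable instance : MulAction (GL (Fin 2) F) (Lattice F) where
  smul g L := ⟨g • L.1, isLattice_smul g L.2⟩
  one_smul L := Lattice.ext (one_smul _ L.1)
  mul_smul g h L := Lattice.ext (mul_smul g h L.1)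

theorem coe_smul (g : GL (Fin 2) F) (L : Lattice F) : (g • L).1 = g • L.1 := rfl

theorem smul_scalar_comm (g : GL (Fin 2) F) (c : Fˣ) (L : Submodule 𝒪[F] (Fin 2 → F)) :
    g • c • L = c • g • L := by
  have h : (DistribSMul.toLinearMap 𝒪[F] (Fin 2 → F) g).comp
        (DistribSMul.toLinearMap 𝒪[F] (Fin 2 → F) c) =
      (DistribSMul.toLinearMap 𝒪[F] (Fin 2 → F) c).comp
        (DistribSMul.toLinearMap 𝒪[F] (Fin 2 → F) g) :=
    LinearMap.ext fun v => smul_comm g c v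
  exact (Submodule.map_comp _ _ L).symm.trans
    ((congrArg (fun f => Submodule.map f L) h).trans (Submodule.map_comp _ _ L))

variable (F) in
/-- Two lattices are homothetic if one is `c` times the other, for some `c ∈ Fˣ`. -/
instance homothety : Setoid (Lattice F) where
  r L M := ∃ c : Fˣ, M.1 = c • L.1
  iseqv :=
    { refl := fun L => ⟨1, (one_smul _ _).symm⟩
      symm := fun {L M} ⟨c, hc⟩ => ⟨c⁻¹, by rw [hc, inv_smul_smul]⟩
      trans := fun {L M N} ⟨c, hc⟩ ⟨d, hd⟩ => ⟨d * c, by rw [hd, hc, mul_smul]⟩ }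

variable (F) in
/-- The vertices of the tree: homothety classes of lattices in `F²`. -/
def Vertex : Type _ := Quotient (homothety F)

/-- The vertex given by a lattice. -/
def Lattice.toVertex (L : Lattice F) : Vertex F := Quotient.mk (homothety F) L

theorem toVertex_eq_iff {L M : Lattice F} :
    L.toVertex = M.toVertex ↔ ∃ c : Fˣ, M.1 = c • L.1 := Quotient.eq

/-- The action of `G = GL₂(F)` on the vertices. -/
noncomputable instance : MulAction (GL (Fin 2) F) (Vertex F) where
  smul g := Quotient.map (fun L => g • L) (by
    rintro L M ⟨c, hc⟩
    exact ⟨c, by rw [coe_smul, coe_smul, hc, smul_scalar_comm]⟩)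
  one_smul x := by
    induction x using Quotient.inductionOn with
    | h L => exact congrArg Lattice.toVertex (one_smul _ L)
  mul_smul g h x := by
    induction x using Quotient.inductionOn with
    | h L => exact congrArg Lattice.toVertex (mul_smul g h L)

theorem smul_toVertex (g : GL (Fin 2) F) (L : Lattice F) :
    g • L.toVertex = (g • L).toVertex := rfl

theorem smul_maximalIdeal_smul (g : GL (Fin 2) F) (L : Submodule 𝒪[F] (Fin 2 → F)) :
    g • (𝓂[F] • L) = 𝓂[F] • (g • L) :=
  Submodule.map_smul'' _ _ _

variable (F) in
/-- The Bruhat-Tits tree `X`: two distinct vertices are adjacent if they are represented by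
lattices `L`, `M` with `𝔪 L ⊊ M ⊊ L`. -/
def tree : SimpleGraph (Vertex F) :=
  SimpleGraph.fromRel fun x y =>
    ∃ L M : Lattice F, L.toVertex = x ∧ M.toVertex = y ∧ 𝓂[F] • L.1 < M.1 ∧ M.1 < L.1

theorem tree_adj_smul {g : GL (Fin 2) F} {x y : Vertex F} (h : (tree F).Adj x y) :
    (tree F).Adj (g • x) (g • y) := by
  have mono : ∀ {A B : Submodule 𝒪[F] (Fin 2 → F)}, A < B → g • A < g • B := fun {A B} hAB =>
    lt_of_le_of_ne (Submodule.map_mono hAB.le) fun he => hAB.ne (smul_left_cancel g he)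
  have key : ∀ {a b : Vertex F},
      (∃ L M : Lattice F, L.toVertex = a ∧ M.toVertex = b ∧ 𝓂[F] • L.1 < M.1 ∧ M.1 < L.1) →
      ∃ L M : Lattice F, L.toVertex = g • a ∧ M.toVertex = g • b ∧
        𝓂[F] • L.1 < M.1 ∧ M.1 < L.1 := by
    rintro a b ⟨L, M, rfl, rfl, h1, h2⟩
    refine ⟨g • L, g • M, rfl, rfl, ?_, mono h2⟩
    rw [coe_smul, coe_smul, ← smul_maximalIdeal_smul]
    exact mono h1
  rw [tree, SimpleGraph.fromRel_adj] at h ⊢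
  exact ⟨fun he => h.1 (smul_left_cancel g he), h.2.imp key key⟩

theorem tree_adj_smul_iff {g : GL (Fin 2) F} {x y : Vertex F} :
    (tree F).Adj (g • x) (g • y) ↔ (tree F).Adj x y :=
  ⟨fun h => by simpa using tree_adj_smul (g := g⁻¹) h, tree_adj_smul⟩

variable (F) in
/-- The automorphism group `Aut(X)`: the permutations of the vertices preserving the distance
`d(x, y)`, the number of edges of the geodesic from `x` to `y`. -/
def treeAut : Subgroup (Equiv.Perm (Vertex F)) where
  carrier := {g | ∀ x y, (tree F).dist (g x) (g y) = (tree F).dist x y}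
  mul_mem' {g h} hg hh x y := (hg _ _).trans (hh _ _)
  one_mem' _ _ := rfl
  inv_mem' {g} hg x y := by simpa using (hg (g⁻¹ x) (g⁻¹ y)).symm

theorem adj_apply_iff {g : Equiv.Perm (Vertex F)} (hg : g ∈ treeAut F) {x y : Vertex F} :
    (tree F).Adj (g x) (g y) ↔ (tree F).Adj x y := by
  rw [← SimpleGraph.dist_eq_one_iff_adj, ← SimpleGraph.dist_eq_one_iff_adj, hg x y]

theorem toPerm_mem_treeAut (g : GL (Fin 2) F) :
    MulAction.toPermHom (GL (Fin 2) F) (Vertex F) g ∈ treeAut F := by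
  have le : ∀ (h : GL (Fin 2) F) (x y : Vertex F),
      (tree F).edist (h • x) (h • y) ≤ (tree F).edist x y := by
    intro h x y
    by_cases hxy : (tree F).edist x y = ⊤
    · rw [hxy]; exact le_top
    obtain ⟨w, hw⟩ :=
      (SimpleGraph.reachable_of_edist_ne_top hxy).exists_walk_length_eq_edist
    let φ : tree F →g tree F := ⟨fun z => h • z, tree_adj_smul⟩
    rw [← hw, ← SimpleGraph.Walk.length_map φ w]
    exact SimpleGraph.edist_le _
  intro x y
  have h2 := le g⁻¹ (g • x) (g • y)
  rw [inv_smul_smul, inv_smul_smul] at h2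
  exact congrArg ENat.toNat (le_antisymm (le g x y) h2)

/-- The ball `Z^{(e)}(x) = {y | d(x, y) ≤ e}`. -/
def ballV (e : ℕ) (x : Vertex F) : Set (Vertex F) := {y | (tree F).dist x y ≤ e}

/-- `Z^{(e)}(τ) = Z^{(e)}(x) ∪ Z^{(e)}(y)` for the edge `τ = {x, y}`. -/
def ballE (e : ℕ) (x y : Vertex F) : Set (Vertex F) := ballV e x ∪ ballV e y

theorem apply_mem_ballE {g : Equiv.Perm (Vertex F)} (hg : g ∈ treeAut F) {e : ℕ}
    {x y z : Vertex F} (hz : z ∈ ballE e x y) : g z ∈ ballE e (g x) (g y) := by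
  simpa only [ballE, ballV, Set.mem_union, Set.mem_ofPred_eq, hg x z, hg y z] using hz

/-! ### The subgroups of `GL₂(F)` -/

/-- The maximal compact subgroup `K_x ⊆ G` fixing `x`: the elements `g` with `g L = L` for the
lattices `L` representing `x` (see `isGreatest_K` below). -/
def K (x : Vertex F) : Subgroup (GL (Fin 2) F) where
  carrier := {g | ∀ L : Lattice F, L.toVertex = x → g • L.1 = L.1}
  mul_mem' {g h} hg hh L hL := by rw [mul_smul, hh L hL, hg L hL]
  one_mem' L _ := one_smul _ _
  inv_mem' {g} hg L hL := by rw [inv_smul_eq_iff, hg L hL]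

theorem mem_K_iff {x : Vertex F} {g : GL (Fin 2) F} :
    g ∈ K x ↔ ∀ L : Lattice F, L.toVertex = x → g • L.1 = L.1 := Iff.rfl

/-- The pro-`p` radical `U_x^{(1)}` of `K_x`: the kernel of the reduction map
`K_x → Aut(L / 𝔪 L)`, where the lattice `L` represents `x`. It is the maximal normal
pro-`p`-subgroup of `K_x`, where `p` is the residue characteristic (see `isGreatest_U1` below). -/
def U1 (x : Vertex F) : Subgroup (GL (Fin 2) F) where
  carrier := {g | g ∈ K x ∧ ∀ L : Lattice F, L.toVertex = x → ∀ v ∈ L.1, g • v - v ∈ 𝓂[F] • L.1}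
  mul_mem' {g h} hg hh := by
    refine ⟨mul_mem hg.1 hh.1, fun L hL v hv => ?_⟩
    have h1 : g • (h • v - v) ∈ 𝓂[F] • L.1 := by
      have h3 : g • (𝓂[F] • L.1) = 𝓂[F] • L.1 := by rw [smul_maximalIdeal_smul, hg.1 L hL]
      exact h3 ▸ Submodule.smul_mem_pointwise_smul _ g _ (hh.2 L hL v hv)
    have h2 := add_mem h1 (hg.2 L hL v hv)
    rwa [smul_sub, sub_add_sub_cancel, ← mul_smul] at h2
  one_mem' := ⟨one_mem _, fun L _ v _ => by simp⟩
  inv_mem' {g} hg := by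
    refine ⟨inv_mem hg.1, fun L hL v hv => ?_⟩
    have h0 := (inv_mem hg.1) L hL
    have h1 : g⁻¹ • (g • v - v) ∈ 𝓂[F] • L.1 := by
      have h3 : g⁻¹ • (𝓂[F] • L.1) = 𝓂[F] • L.1 := by rw [smul_maximalIdeal_smul, h0]
      exact h3 ▸ Submodule.smul_mem_pointwise_smul _ g⁻¹ _ (hg.2 L hL v hv)
    rw [smul_sub, inv_smul_smul] at h1
    simpa using neg_mem h1

/-- `U_x^{(e)} = ⋂ U_y^{(1)}` over the vertices `y` with `d(x, y) ≤ e - 1`. -/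
def UV (e : ℕ) (x : Vertex F) : Subgroup (GL (Fin 2) F) :=
  ⨅ (y : Vertex F) (_ : (tree F).dist x y + 1 ≤ e), U1 y

/-- For the edge `τ = {x, y}`, `U_τ^{(e)}` is the subgroup of `G` generated by `U_x^{(e)}` and
`U_y^{(e)}`. -/
def UE (e : ℕ) (x y : Vertex F) : Subgroup (GL (Fin 2) F) := UV e x ⊔ UV e y

/-! ### Locally algebraic automorphisms of the tree -/

/-- The automorphisms `g` of `X` such that for every edge `μ` there is `g' ∈ H` such that `g` and
`g'` coincide on `Z^{(e)}(μ)`. -/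
def locallyIn (e : ℕ) (H : Subgroup (GL (Fin 2) F)) : Subgroup (Equiv.Perm (Vertex F)) where
  carrier := {g | g ∈ treeAut F ∧ ∀ x y : Vertex F, (tree F).Adj x y →
    ∃ g' ∈ H, ∀ z ∈ ballE e x y, g z = g' • z}
  mul_mem' {g h} hg hh := by
    refine ⟨mul_mem hg.1 hh.1, fun x y hxy => ?_⟩
    obtain ⟨h', hh', hhz⟩ := hh.2 x y hxy
    obtain ⟨g', hg', hgz⟩ := hg.2 (h x) (h y) ((adj_apply_iff hh.1).2 hxy)
    refine ⟨g' * h', mul_mem hg' hh', fun z hz => ?_⟩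
    rw [Equiv.Perm.mul_apply, hgz _ (apply_mem_ballE hh.1 hz), hhz z hz, mul_smul]
  one_mem' := ⟨one_mem _, fun x y _ => ⟨1, one_mem _, fun z _ => (one_smul _ z).symm⟩⟩
  inv_mem' {g} hg := by
    have hi := inv_mem hg.1
    refine ⟨hi, fun x y hxy => ?_⟩
    obtain ⟨g', hg', hgz⟩ := hg.2 (g⁻¹ x) (g⁻¹ y) ((adj_apply_iff hi).2 hxy)
    refine ⟨g'⁻¹, inv_mem hg', fun z hz => ?_⟩
    have := hgz _ (apply_mem_ballE hi hz)
    rw [← Equiv.Perm.mul_apply, mul_inv_cancel, Equiv.Perm.one_apply] at this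
    rw [eq_inv_smul_iff, ← this]

variable (F) in
/-- `Ĝ^{(e)}`, the group of locally algebraic automorphisms of `X` of level `e`. -/
abbrev Ghat (e : ℕ) : Subgroup (Equiv.Perm (Vertex F)) := locallyIn e ⊤

theorem toPerm_mem_locallyIn (e : ℕ) {H : Subgroup (GL (Fin 2) F)} {g : GL (Fin 2) F}
    (hg : g ∈ H) : MulAction.toPermHom (GL (Fin 2) F) (Vertex F) g ∈ locallyIn e H :=
  ⟨toPerm_mem_treeAut g, fun _ _ _ => ⟨g, hg, fun _ _ => rfl⟩⟩

variable (F) in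
/-- The natural map `G → Ĝ^{(e)}`, given by the action of `G` on the tree. -/
noncomputable def toGhat (e : ℕ) : GL (Fin 2) F →* Ghat F e :=
  (MulAction.toPermHom (GL (Fin 2) F) (Vertex F)).codRestrict (Ghat F e)
    fun _ => toPerm_mem_locallyIn e (Subgroup.mem_top _)

/-- The subgroup `Û_η^{(e)}` of `Ĝ^{(e)}`, for the edge `η = {x, y}`: the automorphisms which on
each `Z^{(e)}(μ)` coincide with an element of `U_η^{(e)}`. -/
def Uhat (e : ℕ) (x y : Vertex F) : Subgroup (Ghat F e) :=
  (locallyIn e (UE e x y)).subgroupOf (Ghat F e)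

/-- The map `G → Ĝ^{(e)}` restricts to a map `U_η^{(e)} → Û_η^{(e)}`. -/
theorem toGhat_mem_Uhat {e : ℕ} {x y : Vertex F} {u : GL (Fin 2) F} (hu : u ∈ UE e x y) :
    toGhat F e u ∈ Uhat e x y :=
  Subgroup.mem_subgroupOf.2 (toPerm_mem_locallyIn e hu)

/-- Any `g` in `Aut(X)` that locally lies in a subgroup `H` lies in `Ĝ^{(e)}`, so that
`Û_η^{(e)}` consists of all automorphisms of `X` with its defining property. -/
theorem locallyIn_le_Ghat (e : ℕ) (H : Subgroup (GL (Fin 2) F)) : locallyIn e H ≤ Ghat F e :=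
  fun _ hg => ⟨hg.1, fun x y hxy =>
    let ⟨g', _, hz⟩ := hg.2 x y hxy
    ⟨g', Subgroup.mem_top _, hz⟩⟩

end Tree

/-! ### Representations of `Ĝ^{(e)}` -/

section Representations

open HeckeAction

variable {F : Type*} [Field F] [ValuativeRel F] {Λ : Type*} [CommRing Λ]
  {V : Type*} [AddCommGroup V] [Module Λ V] {e : ℕ}

/-- The condition on a `Ĝ^{(e)}`-representation `V` over `Λ` to be an object of
`R̂₀^{(e)}(Λ)`, where `σ = {x, y}`: it is generated by its `Û_σ^{(e)}`-fixed vectors, and its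
restriction to `Û_σ^{(e)}` is smooth. Here `Û_σ^{(e)}` carries the pro-`p`-topology of the inverse
limit of its images in the symmetric groups of the finite sets `Z^{(m)}(σ)`: the pointwise
stabilizers of the `Z^{(m)}(σ)` are a basis of neighbourhoods of `1`. -/
structure IsInRhat (ρ : Representation Λ (Ghat F e) V) (x y : Vertex F) : Prop where
  generated : Submodule.span Λ
    {w : V | ∃ g : Ghat F e, ∃ v ∈ fixedVectors ρ (Uhat e x y), w = ρ g v} = ⊤
  smooth : ∀ v : V, ∃ m : ℕ, ∀ u ∈ Uhat e x y,
    (∀ z ∈ ballE m x y, (u : Equiv.Perm (Vertex F)) z = z) → ρ u v = v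

/-- `V^{Û_σ^{(e)}} ⊆ V^{U_σ^{(e)}}`, where `G` acts on `V` through `G → Ĝ^{(e)}`. -/
theorem fixedVectors_le (ρ : Representation Λ (Ghat F e) V) (x y : Vertex F) :
    fixedVectors ρ (Uhat e x y) ≤ fixedVectors (ρ.comp (toGhat F e)) (UE e x y) :=
  fun _ hv => mem_fixedVectors.2 fun _ hu => mem_fixedVectors.1 hv _ (toGhat_mem_Uhat hu)

end Representations

end BTTree

namespace BTTree

/-! ### `K_x` is the maximal compact subgroup fixing `x`, and `U_x^{(1)}` is its maximal normal
pro-`p`-subgroup -/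

section ProP

set_option linter.unusedSectionVars false

open Matrix

variable {F : Type*} [Field F] [ValuativeRel F]

/-- The lattice `𝒪²`. -/
def stdSub : Submodule 𝒪[F] (Fin 2 → F) where
  carrier := {w | ∀ i, ValuativeRel.valuation F (w i) ≤ 1}
  add_mem' {a b} ha hb i := (Valuation.map_add _ _ _).trans (max_le (ha i) (hb i))
  zero_mem' i := by simp
  smul_mem' c w hw i := by
    have : (c • w) i = (c : F) * w i := rfl
    rw [this, map_mul]
    exact mul_le_one' c.2 (hw i)

theorem mem_stdSub {w : Fin 2 → F} : w ∈ stdSub ↔ ∀ i, ValuativeRel.valuation F (w i) ≤ 1 := Iff.rfl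

theorem toMatrix_smul {F : Type*} [Field F] (g : GL (Fin 2) F) (w : Fin 2 → F) : g • w = (g : Matrix (Fin 2) (Fin 2) F) *ᵥ w := rfl

theorem smul_stdSub_le_iff {g : GL (Fin 2) F} :
    g • (stdSub : Submodule 𝒪[F] (Fin 2 → F)) ≤ stdSub ↔
      ∀ i j, ValuativeRel.valuation F ((g : Matrix (Fin 2) (Fin 2) F) i j) ≤ 1 := by
  constructor
  · intro h i j
    have h1 : (Pi.single j 1 : Fin 2 → F) ∈ (stdSub : Submodule 𝒪[F] (Fin 2 → F)) := fun k => by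
      by_cases hk : k = j
      · subst hk; simp
      · simp [hk]
    have h2 := h (Submodule.smul_mem_pointwise_smul _ g _ h1) i
    rw [toMatrix_smul] at h2
    simpa using h2
  · rintro h _ ⟨w, hw, rfl⟩ i
    change ValuativeRel.valuation F ((g • w) i) ≤ 1
    rw [toMatrix_smul, Matrix.mulVec, dotProduct]
    refine Valuation.map_sum_le _ fun j _ => ?_
    rw [map_mul]
    exact mul_le_one' (h i j) (hw j)

theorem smul_stdSub_eq_iff {g : GL (Fin 2) F} :
    g • (stdSub : Submodule 𝒪[F] (Fin 2 → F)) = stdSub ↔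
      (∀ i j, ValuativeRel.valuation F ((g : Matrix (Fin 2) (Fin 2) F) i j) ≤ 1) ∧
        ∀ i j, ValuativeRel.valuation F (((g⁻¹ : GL (Fin 2) F) : Matrix (Fin 2) (Fin 2) F) i j) ≤ 1 := by
  rw [← smul_stdSub_le_iff, ← smul_stdSub_le_iff]
  constructor
  · intro h
    refine ⟨h.le, ?_⟩
    conv_lhs => rw [← h]
    rw [inv_smul_smul]
  · rintro ⟨h1, h2⟩
    refine le_antisymm h1 ?_
    have : g • g⁻¹ • (stdSub : Submodule 𝒪[F] (Fin 2 → F)) ≤ g • stdSub := Submodule.map_mono h2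
    rwa [smul_inv_smul] at this

variable [TopologicalSpace F] [IsNonarchimedeanLocalField F]

instance : IsFractionRing 𝒪[F] F := by
  have := (Valuation.integer.integers (ValuativeRel.valuation F)).isFractionRing
  exact this

theorem exists_frame (L : Lattice F) : ∃ g : GL (Fin 2) F, L.1 = g • stdSub := by
  have := L.2
  have : Module.IsTorsionFree 𝒪[F] F := inferInstance
  have : Module.Free 𝒪[F] L.1 := Submodule.IsLattice.free F L.1
  have hr : Module.finrank 𝒪[F] L.1 = 2 := by
    simpa using Submodule.IsLattice.finrank_of_pi (K := F) L.1
  let b : Module.Basis (Fin 2) 𝒪[F] L.1 := Module.finBasisOfFinrankEq _ _ hr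
  let B : Module.Basis (Fin 2) F (Fin 2 → F) := b.extendOfIsLattice F
  have hB : ∀ i, B i = (b i : Fin 2 → F) := fun i => Module.Basis.extendOfIsLattice_apply F b i
  let e : (Fin 2 → F) ≃ₗ[F] (Fin 2 → F) := B.equivFun.symm
  let g : GL (Fin 2) F := ⟨LinearMap.toMatrix' e.toLinearMap, LinearMap.toMatrix' e.symm.toLinearMap,
    by rw [← LinearMap.toMatrix'_comp, LinearEquiv.comp_symm, LinearMap.toMatrix'_id],
    by rw [← LinearMap.toMatrix'_comp, LinearEquiv.symm_comp, LinearMap.toMatrix'_id]⟩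
  have hg : ∀ w, g • w = ∑ i, w i • (b i : Fin 2 → F) := fun w => by
    rw [toMatrix_smul]
    change LinearMap.toMatrix' e.toLinearMap *ᵥ w = _
    rw [LinearMap.toMatrix'_mulVec]
    change B.equivFun.symm w = _
    rw [Module.Basis.equivFun_symm_apply]
    simp only [hB]
  refine ⟨g, le_antisymm (fun x hx => ?_) ?_⟩
  · refine ⟨fun i => (b.repr ⟨x, hx⟩ i : F), fun i => (b.repr ⟨x, hx⟩ i).2, ?_⟩
    change g • _ = x
    rw [hg]
    have := congrArg Subtype.val (b.sum_repr ⟨x, hx⟩)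
    rw [AddSubmonoidClass.coe_finsetSum] at this
    exact this
  · rintro _ ⟨w, hw, rfl⟩
    change g • w ∈ L.1
    rw [hg]
    exact sum_mem fun i _ => L.1.smul_mem (⟨w i, hw i⟩ : 𝒪[F]) (b i).2

/-- A uniformizer. -/
theorem exists_unif : ∃ π : F, ValuativeRel.valuation F π < 1 ∧ ValuativeRel.valuation F π ≠ 0 ∧ ∀ x : F, ValuativeRel.valuation F x < 1 → ValuativeRel.valuation F x ≤ ValuativeRel.valuation F π := by
  obtain ⟨π, hπ⟩ := IsDiscreteValuationRing.exists_irreducible 𝒪[F]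
  have hm : ∀ x : 𝒪[F], x ∈ 𝓂[F] ↔ ValuativeRel.valuation F (x : F) < 1 := fun x =>
    (IsLocalRing.mem_maximalIdeal x).trans Valuation.Integer.not_isUnit_iff_valuation_lt_one
  have hmem : π ∈ 𝓂[F] := hπ.1
  refine ⟨π, (hm π).1 hmem, ?_, fun x hx => ?_⟩
  · rw [Valuation.ne_zero_iff]
    exact fun h => hπ.ne_zero (Subtype.ext h)
  · have hx' : (⟨x, hx.le⟩ : 𝒪[F]) ∈ 𝓂[F] := (hm _).2 hx
    rw [hπ.maximalIdeal_eq, Ideal.mem_span_singleton] at hx'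
    obtain ⟨y, hy⟩ := hx'
    have : x = (π : F) * y := congrArg Subtype.val hy
    rw [this, map_mul]
    exact mul_le_of_le_one_right' y.2

theorem mem_maximalIdeal_smul_stdSub {w : Fin 2 → F} :
    w ∈ 𝓂[F] • (stdSub : Submodule 𝒪[F] (Fin 2 → F)) ↔ ∀ i, ValuativeRel.valuation F (w i) < 1 := by
  constructor
  · intro hw
    refine Submodule.smul_induction_on hw (fun r hr u hu i => ?_) fun a b ha hb i => ?_
    · have h1 : ValuativeRel.valuation F (r : F) < 1 := Valuation.Integer.not_isUnit_iff_valuation_lt_one.1 hr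
      have h2 : (r • u) i = (r : F) * u i := rfl
      rw [h2, map_mul]
      exact mul_lt_one_of_lt_of_le h1 (hu i)
    · exact lt_of_le_of_lt (Valuation.map_add _ _ _) (max_lt (ha i) (hb i))
  · intro hw
    obtain ⟨π, h1, h0, hπ⟩ := exists_unif (F := F)
    have hπ0 : π ≠ 0 := (Valuation.ne_zero_iff _).1 h0
    have hm : (⟨π, h1.le⟩ : 𝒪[F]) ∈ 𝓂[F] :=
      Valuation.Integer.not_isUnit_iff_valuation_lt_one.2 h1
    have hw' : w = (⟨π, h1.le⟩ : 𝒪[F]) • fun i => π⁻¹ * w i := by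
      funext i
      exact (mul_inv_cancel_left₀ hπ0 (w i)).symm
    rw [hw']
    refine Submodule.smul_mem_smul hm fun i => ?_
    rw [map_mul, map_inv₀, inv_mul_le_iff₀ (zero_lt_iff.2 h0), mul_one]
    exact hπ _ (hw i)

theorem mem_K_of_lattice {g : GL (Fin 2) F} {L : Lattice F} :
    g ∈ K L.toVertex ↔ g • L.toSubmodule = L.toSubmodule := by
  refine ⟨fun h => h L rfl, fun h M hM => ?_⟩
  obtain ⟨c, hc⟩ := toVertex_eq_iff.1 hM.symm
  rw [hc, smul_scalar_comm, h]

theorem mem_U1_of_lattice {g : GL (Fin 2) F} {L : Lattice F} :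
    g ∈ U1 L.toVertex ↔ g • L.toSubmodule = L.toSubmodule ∧
      ∀ w ∈ L.toSubmodule, g • w - w ∈ 𝓂[F] • L.toSubmodule := by
  refine ⟨fun h => ⟨h.1 L rfl, h.2 L rfl⟩, fun h => ⟨mem_K_of_lattice.2 h.1, fun M hM w hw => ?_⟩⟩
  obtain ⟨c, hc⟩ := toVertex_eq_iff.1 hM.symm
  rw [hc] at hw ⊢
  obtain ⟨u, hu, rfl⟩ := hw
  have h1 : c • (𝓂[F] • L.toSubmodule) = 𝓂[F] • (c • L.toSubmodule) :=
    Submodule.map_smul'' _ _ _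
  rw [← h1]
  refine ⟨_, h.2 u hu, ?_⟩
  change c • (g • u - u) = g • c • u - c • u
  rw [smul_sub, smul_comm]

theorem mem_K_frame {L : Lattice F} {g₀ : GL (Fin 2) F} (hL : L.toSubmodule = g₀ • stdSub)
    {g : GL (Fin 2) F} : g ∈ K L.toVertex ↔
      (∀ i j, ValuativeRel.valuation F ((g₀⁻¹ * g * g₀ : GL (Fin 2) F) i j) ≤ 1) ∧
        ∀ i j, ValuativeRel.valuation F (((g₀⁻¹ * g * g₀)⁻¹ : GL (Fin 2) F) i j) ≤ 1 := by
  rw [mem_K_of_lattice, ← smul_stdSub_eq_iff, hL, mul_smul, mul_smul, inv_smul_eq_iff]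

theorem mem_U1_frame {L : Lattice F} {g₀ : GL (Fin 2) F} (hL : L.toSubmodule = g₀ • stdSub)
    {g : GL (Fin 2) F} : g ∈ U1 L.toVertex ↔ g ∈ K L.toVertex ∧
      ∀ i j, ValuativeRel.valuation F ((g₀⁻¹ * g * g₀ : GL (Fin 2) F) i j - (1 : Matrix (Fin 2) (Fin 2) F) i j) < 1 := by
  rw [mem_U1_of_lattice, mem_K_of_lattice]
  refine and_congr_right fun _ => ?_
  have key : ∀ u : Fin 2 → F, (g • g₀ • u - g₀ • u ∈ 𝓂[F] • L.toSubmodule ↔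
      ∀ i, ValuativeRel.valuation F ((((g₀⁻¹ * g * g₀ : GL (Fin 2) F) : Matrix (Fin 2) (Fin 2) F) *ᵥ u) i - u i) < 1) := by
    intro u
    have e1 : g • g₀ • u - g₀ • u = g₀ • ((g₀⁻¹ * g * g₀) • u - u) := by
      rw [smul_sub, smul_smul g₀, smul_smul g]
      congr 2
      group
    rw [e1, hL, ← smul_maximalIdeal_smul, ← mem_maximalIdeal_smul_stdSub (w := fun i => _ - u i)]
    exact ⟨fun ⟨w, hw, he⟩ => (show w = fun i => _ - u i from smul_left_cancel g₀ he) ▸ hw,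
      fun h => Submodule.smul_mem_pointwise_smul _ g₀ _ h⟩
  rw [hL] at *
  constructor
  · intro h i j
    have h1 : (Pi.single j 1 : Fin 2 → F) ∈ (stdSub : Submodule 𝒪[F] (Fin 2 → F)) := fun k => by
      by_cases hk : k = j
      · subst hk; simp
      · simp [hk]
    have h2 := (key _).1 (h _ (Submodule.smul_mem_pointwise_smul _ g₀ _ h1)) i
    simpa [Matrix.one_apply, Pi.single_apply] using h2
  · rintro h _ ⟨u, hu, rfl⟩
    refine (key u).2 fun i => ?_
    have e2 : (((g₀⁻¹ * g * g₀ : GL (Fin 2) F) : Matrix (Fin 2) (Fin 2) F) *ᵥ u) i - u i =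
        ∑ j, ((g₀⁻¹ * g * g₀ : GL (Fin 2) F) i j - (1 : Matrix (Fin 2) (Fin 2) F) i j) * u j := by
      have : u i = ((1 : Matrix (Fin 2) (Fin 2) F) *ᵥ u) i := by rw [Matrix.one_mulVec]
      conv_lhs => rw [this]
      rw [Matrix.mulVec, Matrix.mulVec, dotProduct, dotProduct, ← Finset.sum_sub_distrib]
      simp only [sub_mul]
    rw [e2]
    refine Valuation.map_sum_lt _ one_ne_zero fun j _ => ?_
    rw [map_mul]
    exact mul_lt_one_of_lt_of_le (h i j) (hu j)

/-- The matrices all of whose entries have valuation at most `c`. -/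
def smallMat (c : ValuativeRel.ValueGroupWithZero F) : Set (Matrix (Fin 2) (Fin 2) F) :=
  {A | ∀ i j, ValuativeRel.valuation F (A i j) ≤ c}

theorem smallMat_mul {a b : ValuativeRel.ValueGroupWithZero F} {A B : Matrix (Fin 2) (Fin 2) F}
    (hA : A ∈ smallMat a) (hB : B ∈ smallMat b) : A * B ∈ smallMat (a * b) := fun i j => by
  rw [Matrix.mul_apply]
  refine Valuation.map_sum_le _ fun k _ => ?_
  rw [map_mul]
  exact mul_le_mul' (hA i k) (hB k j)

theorem smallMat_add {a : ValuativeRel.ValueGroupWithZero F} {A B : Matrix (Fin 2) (Fin 2) F}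
    (hA : A ∈ smallMat a) (hB : B ∈ smallMat a) : A + B ∈ smallMat a := fun i j =>
  (Valuation.map_add _ _ _).trans (max_le (hA i j) (hB i j))

theorem one_mem_smallMat : (1 : Matrix (Fin 2) (Fin 2) F) ∈ smallMat 1 := fun i j => by
  by_cases h : i = j
  · subst h; simp
  · simp [h]

theorem pow_sub_one_mem {c : ValuativeRel.ValueGroupWithZero F} (hc : c ≤ 1)
    {A : Matrix (Fin 2) (Fin 2) F} (hA : A - 1 ∈ smallMat c) (n : ℕ) :
    A ^ n - 1 ∈ smallMat c ∧ A ^ n ∈ smallMat 1 := by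
  have hle : smallMat (F := F) c ⊆ smallMat 1 := fun B hB i j => (hB i j).trans hc
  have hA1 : A ∈ smallMat 1 := by
    simpa using smallMat_add (hle hA) one_mem_smallMat
  induction n with
  | zero => exact ⟨by simp [smallMat], by simpa using one_mem_smallMat⟩
  | succ n ih =>
    have h : A ^ (n + 1) - 1 = (A ^ n - 1) * A + (A - 1) := by rw [pow_succ]; noncomm_ring
    have h2 : A ^ (n + 1) - 1 ∈ smallMat c := by
      rw [h]
      exact smallMat_add (by simpa using smallMat_mul ih.1 hA1) hA
    exact ⟨h2, by simpa using smallMat_add (hle h2) one_mem_smallMat⟩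

theorem pow_p_sub_one_mem {p : ℕ} {a c : ValuativeRel.ValueGroupWithZero F} (hc : c ≤ 1)
    (hac : a ≤ c) (hp : ValuativeRel.valuation F (p : F) ≤ c)
    {A : Matrix (Fin 2) (Fin 2) F} (hA : A - 1 ∈ smallMat a) :
    A ^ p - 1 ∈ smallMat (a * c) := by
  have hA' : A - 1 ∈ smallMat c := fun i j => (hA i j).trans hac
  rw [← mul_geom_sum]
  refine smallMat_mul hA ?_
  have h1 : ∑ i ∈ Finset.range p, A ^ i = ∑ i ∈ Finset.range p, (A ^ i - 1) + (p : F) • 1 := by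
    rw [Finset.sum_sub_distrib]
    simp [Matrix.smul_one_eq_diagonal, ← Matrix.diagonal_natCast]
  rw [h1]
  refine smallMat_add (fun i j => ?_) fun i j => ?_
  · rw [Matrix.sum_apply]
    exact Valuation.map_sum_le _ fun k _ => (pow_sub_one_mem hc hA' k).1 i j
  · rw [Matrix.smul_apply, smul_eq_mul, map_mul]
    simpa using mul_le_mul' hp (one_mem_smallMat i j)

theorem pow_pow_sub_one_mem {p : ℕ} {c : ValuativeRel.ValueGroupWithZero F} (hc : c ≤ 1)
    (hp : ValuativeRel.valuation F (p : F) ≤ c) {A : Matrix (Fin 2) (Fin 2) F} (hA : A - 1 ∈ smallMat c) (n : ℕ) :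
    A ^ p ^ n - 1 ∈ smallMat (c ^ (n + 1)) := by
  induction n with
  | zero => simpa using hA
  | succ n ih =>
    rw [pow_succ p, pow_mul, pow_succ c]
    refine pow_p_sub_one_mem hc ?_ hp ih
    exact pow_le_of_le_one zero_le hc (Nat.succ_ne_zero n)

theorem isCompact_smallMat (c : ValuativeRel.ValueGroupWithZero F) :
    IsCompact (smallMat (F := F) c) := by
  have h : smallMat (F := F) c =
      Set.univ.pi fun _ : Fin 2 => Set.univ.pi fun _ : Fin 2 => {x : F | ValuativeRel.valuation F x ≤ c} := by
    ext A; exact ⟨fun h i _ j _ => h i j, fun h i j => h i trivial j trivial⟩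
  rw [h]
  exact isCompact_univ_pi fun _ => isCompact_univ_pi fun _ =>
    IsNonarchimedeanLocalField.isCompact_closedBall F c

theorem smallMat_mem_nhds {c : ValuativeRel.ValueGroupWithZero F} (hc : c ≠ 0) :
    smallMat (F := F) c ∈ nhds 0 := by
  have h : smallMat (F := F) c =
      Set.univ.pi fun _ : Fin 2 => Set.univ.pi fun _ : Fin 2 => {x : F | ValuativeRel.valuation F x ≤ c} := by
    ext A; exact ⟨fun h i _ j _ => h i j, fun h i j => h i trivial j trivial⟩
  rw [h]
  have h0 : {x : F | ValuativeRel.valuation F x ≤ c} ∈ nhds (0 : F) :=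
    Filter.mem_of_superset ((IsValuativeTopology.hasBasis_nhds_zero' F).mem_of_mem hc)
      fun x hx => (le_of_lt hx : ValuativeRel.valuation F x ≤ c)
  exact set_pi_mem_nhds Set.finite_univ fun _ _ => set_pi_mem_nhds Set.finite_univ fun _ _ => h0

/-- The elements `g` of `GL₂(F)` such that `g - 1` and `g⁻¹ - 1` have entries of valuation at
most `c`. -/
def smallGL (c : ValuativeRel.ValueGroupWithZero F) : Set (GL (Fin 2) F) :=
  {g | (g : Matrix (Fin 2) (Fin 2) F) - 1 ∈ smallMat c ∧
    ((g⁻¹ : GL (Fin 2) F) : Matrix (Fin 2) (Fin 2) F) - 1 ∈ smallMat c}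

theorem smallGL_mem_nhds {c : ValuativeRel.ValueGroupWithZero F} (hc : c ≠ 0) :
    smallGL (F := F) c ∈ nhds 1 := by
  have h1 : Filter.Tendsto (fun g : GL (Fin 2) F => (g : Matrix (Fin 2) (Fin 2) F) - 1)
      (nhds 1) (nhds 0) := by
    have : Continuous fun g : GL (Fin 2) F => (g : Matrix (Fin 2) (Fin 2) F) - 1 :=
      Units.continuous_val.sub continuous_const
    simpa using this.tendsto 1
  have h2 : Filter.Tendsto
      (fun g : GL (Fin 2) F => ((g⁻¹ : GL (Fin 2) F) : Matrix (Fin 2) (Fin 2) F) - 1)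
      (nhds 1) (nhds 0) := by
    have : Filter.Tendsto (fun g : GL (Fin 2) F => g⁻¹) (nhds 1) (nhds 1) := by
      simpa using (continuous_inv (G := GL (Fin 2) F)).tendsto 1
    exact h1.comp this
  exact Filter.inter_mem (h1 (smallMat_mem_nhds hc)) (h2 (smallMat_mem_nhds hc))

theorem isCompact_smallGL (c : ValuativeRel.ValueGroupWithZero F) :
    IsCompact (smallGL (F := F) c) := by
  have hT : T2Space F := IsTopologicalAddGroup.t2Space_of_zero_sep fun x hx =>
    ⟨{y : F | ValuativeRel.valuation F y < ValuativeRel.valuation F x}, (IsValuativeTopology.hasBasis_nhds_zero' F).mem_of_mem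
      ((Valuation.ne_zero_iff _).2 hx), fun h => lt_irrefl _ (show ValuativeRel.valuation F x < ValuativeRel.valuation F x from h)⟩
  have hS : IsCompact ((fun A : Matrix (Fin 2) (Fin 2) F => A + 1) '' smallMat c) :=
    (isCompact_smallMat c).image (continuous_id.add continuous_const)
  have hop : IsCompact (MulOpposite.op '' ((fun A : Matrix (Fin 2) (Fin 2) F => A + 1) ''
      smallMat c)) := hS.image MulOpposite.continuous_op
  have hcl : IsClosed {q : Matrix (Fin 2) (Fin 2) F × (Matrix (Fin 2) (Fin 2) F)ᵐᵒᵖ |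
      q.1 * q.2.unop = 1 ∧ q.2.unop * q.1 = 1} := by
    have c2 : Continuous fun q : Matrix (Fin 2) (Fin 2) F × (Matrix (Fin 2) (Fin 2) F)ᵐᵒᵖ =>
      q.2.unop := MulOpposite.continuous_unop.comp continuous_snd
    exact (isClosed_eq (continuous_fst.mul c2) continuous_const).inter
      (isClosed_eq (c2.mul continuous_fst) continuous_const)
  rw [Units.isEmbedding_embedProduct.isCompact_iff]
  convert (hS.prod hop).inter_right hcl using 1
  ext ⟨a, b⟩
  constructor
  · rintro ⟨g, hg, he⟩
    obtain ⟨rfl, rfl⟩ := Prod.ext_iff.1 he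
    exact ⟨⟨⟨_, hg.1, sub_add_cancel _ _⟩, ⟨_, ⟨_, hg.2, sub_add_cancel _ _⟩, rfl⟩⟩,
      g.mul_inv, g.inv_mul⟩
  · rintro ⟨⟨⟨A, hA, hA'⟩, ⟨_, ⟨B, hB, rfl⟩, hB'⟩⟩, h1, h2⟩
    refine ⟨⟨a, b.unop, h1, h2⟩, ⟨?_, ?_⟩, rfl⟩
    · change a - 1 ∈ _
      rw [← show A + 1 = a from hA', add_sub_cancel_right]; exact hA
    · change b.unop - 1 ∈ _
      rw [← show MulOpposite.op (B + 1) = b from hB', MulOpposite.unop_op, add_sub_cancel_right]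
      exact hB

theorem tendsto_pow_of_smallGL {p : ℕ} {c : ValuativeRel.ValueGroupWithZero F} (hc : c < 1)
    (hp : ValuativeRel.valuation F (p : F) ≤ c) {g : GL (Fin 2) F} (hg : g ∈ smallGL c) :
    Filter.Tendsto (fun n : ℕ => g ^ p ^ n) Filter.atTop (nhds 1) := by
  have hma : MulArchimedean (ValuativeRel.ValueGroupWithZero F) :=
    ValuativeRel.isRankLeOne_iff_mulArchimedean.1 inferInstance
  have key : ∀ A : Matrix (Fin 2) (Fin 2) F, A - 1 ∈ smallMat c →
      Filter.Tendsto (fun n : ℕ => A ^ p ^ n) Filter.atTop (nhds 1) := by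
    intro A hA
    have h0 : Filter.Tendsto (fun n : ℕ => A ^ p ^ n - 1) Filter.atTop (nhds 0) := by
      refine tendsto_pi_nhds.2 fun i => tendsto_pi_nhds.2 fun j => ?_
      refine ((IsValuativeTopology.hasBasis_nhds_zero' F).tendsto_right_iff).2 fun γ hγ => ?_
      obtain ⟨n, hn⟩ := exists_pow_lt₀ hc (Units.mk0 γ hγ)
      refine Filter.eventually_atTop.2 ⟨n, fun m hm => ?_⟩
      refine lt_of_le_of_lt (pow_pow_sub_one_mem hc.le hp hA m i j) (lt_of_le_of_lt ?_ hn)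
      exact pow_le_pow_of_le_one zero_le hc.le (by omega)
    simpa using h0.add_const 1
  rw [Units.isInducing_embedProduct.tendsto_nhds_iff]
  refine Filter.Tendsto.prodMk_nhds (key _ hg.1) ?_
  refine (MulOpposite.continuous_op.tendsto 1).comp ?_
  have := key _ hg.2
  simpa [← Units.val_pow_eq_pow_val] using this

theorem mem_U1_frame' {L : Lattice F} {g₀ : GL (Fin 2) F} (hL : L.toSubmodule = g₀ • stdSub)
    {π : F} (hπ : ValuativeRel.valuation F π < 1) (hπ' : ∀ x : F, ValuativeRel.valuation F x < 1 → ValuativeRel.valuation F x ≤ ValuativeRel.valuation F π) {g : GL (Fin 2) F} :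
    g ∈ U1 L.toVertex ↔ g₀⁻¹ * g * g₀ ∈ smallGL (ValuativeRel.valuation F π) := by
  have hsub : ∀ A : Matrix (Fin 2) (Fin 2) F,
      (∀ i j, ValuativeRel.valuation F (A i j - (1 : Matrix (Fin 2) (Fin 2) F) i j) < 1) ↔ A - 1 ∈ smallMat (ValuativeRel.valuation F π) :=
    fun A => ⟨fun h i j => hπ' _ (h i j), fun h i j => lt_of_le_of_lt (h i j) hπ⟩
  have hone : ∀ A : Matrix (Fin 2) (Fin 2) F, A - 1 ∈ smallMat (ValuativeRel.valuation F π) → A ∈ smallMat 1 :=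
    fun A hA => by
      have : A - 1 ∈ smallMat (F := F) 1 := fun i j => (hA i j).trans hπ.le
      simpa using smallMat_add this one_mem_smallMat
  rw [mem_U1_frame hL, mem_K_frame hL, hsub]
  constructor
  · rintro ⟨⟨_, h2⟩, h3⟩
    refine ⟨h3, fun i j => ?_⟩
    have h4 := smallMat_mul (a := 1) h2 h3 i j
    rw [mul_sub, mul_one, Units.inv_mul, one_mul, ← neg_sub, Matrix.neg_apply,
      Valuation.map_neg] at h4
    exact h4
  · rintro ⟨h1, h2⟩
    exact ⟨⟨hone _ h1, hone _ h2⟩, h1⟩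

/-- A compact set of elements of `F` is bounded. -/
theorem bounded_of_isCompact {C : Set F} (hC : IsCompact C) :
    ∃ γ : ValuativeRel.ValueGroupWithZero F, ∀ x ∈ C, ValuativeRel.valuation F x ≤ γ := by
  obtain ⟨t, -, ht⟩ := hC.elim_nhds_subcover (fun x => {y : F | ValuativeRel.valuation F y ≤ max (ValuativeRel.valuation F x) 1}) fun x _ => by
    have h1 : {y : F | ValuativeRel.valuation F y < 1} ∈ nhds (0 : F) :=
      (IsValuativeTopology.hasBasis_nhds_zero' F).mem_of_mem one_ne_zero
    have h2 : Filter.Tendsto (fun y : F => y - x) (nhds x) (nhds 0) := by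
      have : Continuous fun y : F => y - x := continuous_id.sub continuous_const
      simpa using this.tendsto x
    refine Filter.mem_of_superset (h2 h1) fun y hy => ?_
    have h3 : y = x + (y - x) := by ring
    change ValuativeRel.valuation F y ≤ _
    rw [h3]
    exact (Valuation.map_add _ _ _).trans (max_le_max le_rfl (le_of_lt hy))
  classical
  obtain ⟨γ, hγ⟩ := (t.image fun x => max (ValuativeRel.valuation F x) 1).exists_le
  refine ⟨γ, fun y hy => ?_⟩
  obtain ⟨x, hx, hyx⟩ := Set.mem_iUnion₂.1 (ht hy)
  exact le_trans hyx (hγ _ (Finset.mem_image_of_mem _ hx))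

theorem val_det_le {h : GL (Fin 2) F} {c : Fˣ}
    (hc : h • (stdSub : Submodule 𝒪[F] (Fin 2 → F)) = c • stdSub) :
    ValuativeRel.valuation F (h : Matrix (Fin 2) (Fin 2) F).det ≤ ValuativeRel.valuation F (c : F) ^ 2 := by
  have he : ∀ i j, ValuativeRel.valuation F ((h : Matrix (Fin 2) (Fin 2) F) i j) ≤ ValuativeRel.valuation F (c : F) := by
    intro i j
    have h1 : (Pi.single j 1 : Fin 2 → F) ∈ (stdSub : Submodule 𝒪[F] (Fin 2 → F)) := fun k => by
      by_cases hk : k = j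
      · subst hk; simp
      · simp [hk]
    have h2 : h • (Pi.single j 1 : Fin 2 → F) ∈ c • (stdSub : Submodule 𝒪[F] (Fin 2 → F)) :=
      hc ▸ Submodule.smul_mem_pointwise_smul _ h _ h1
    obtain ⟨w, hw, hw'⟩ := h2
    have h3 : (c : F) * w i = (h : Matrix (Fin 2) (Fin 2) F) i j := by
      have := congrFun hw' i
      rw [toMatrix_smul] at this
      simpa using this
    rw [← h3, map_mul]
    exact mul_le_of_le_one_right' (hw i)
  rw [Matrix.det_fin_two, sq]
  refine (Valuation.map_sub _ _ _).trans (max_le ?_ ?_) <;> rw [map_mul] <;>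
    exact mul_le_mul' (he _ _) (he _ _)

/-- `K_x` is the maximal compact subgroup of `G` fixing `x`. -/
theorem isGreatest_K (x : Vertex F) :
    IsGreatest {H : Subgroup (GL (Fin 2) F) |
      IsCompact (H : Set (GL (Fin 2) F)) ∧ ∀ g ∈ H, g • x = x} (K x) := by
  induction x using Quotient.inductionOn with
  | h L =>
  change IsGreatest {H : Subgroup (GL (Fin 2) F) |
      IsCompact (H : Set (GL (Fin 2) F)) ∧ ∀ g ∈ H, g • L.toVertex = L.toVertex} (K L.toVertex)
  obtain ⟨g₀, hL⟩ := exists_frame L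
  have hma : MulArchimedean (ValuativeRel.ValueGroupWithZero F) :=
    ValuativeRel.isRankLeOne_iff_mulArchimedean.1 inferInstance
  constructor
  · refine ⟨?_, fun g hg => congrArg Lattice.toVertex (Lattice.ext (mem_K_of_lattice.1 hg))⟩
    have hs : ∀ A : Matrix (Fin 2) (Fin 2) F, A - 1 ∈ smallMat 1 ↔ A ∈ smallMat 1 := fun A => by
      have hn : -(1 : Matrix (Fin 2) (Fin 2) F) ∈ smallMat 1 := fun i j => by
        rw [Matrix.neg_apply, Valuation.map_neg]; exact one_mem_smallMat i j
      refine ⟨fun h => by simpa using smallMat_add h one_mem_smallMat, fun h => ?_⟩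
      rw [sub_eq_add_neg]
      exact smallMat_add h hn
    have hK : ∀ {g : GL (Fin 2) F}, g ∈ K L.toVertex ↔ g₀⁻¹ * g * g₀ ∈ smallGL 1 := fun {g} =>
      (mem_K_frame hL).trans (and_congr (hs _).symm (hs _).symm)
    have : (K L.toVertex : Set (GL (Fin 2) F)) = (fun g => g₀ * g * g₀⁻¹) '' smallGL 1 := by
      ext g
      constructor
      · intro hg
        exact ⟨_, hK.1 hg, by group⟩
      · rintro ⟨h, hh, rfl⟩
        refine hK.2 ?_
        convert hh using 1
        group
    rw [this]
    exact (isCompact_smallGL _).image ((continuous_const.mul continuous_id).mul continuous_const)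
  · rintro H ⟨hH, hfix⟩ g hg
    have hdc : Continuous fun h : GL (Fin 2) F => (h : Matrix (Fin 2) (Fin 2) F).det :=
      Units.continuous_val.matrix_det
    obtain ⟨γ, hγ⟩ := bounded_of_isCompact (hH.image hdc)
    have hle : ∀ h ∈ H, ValuativeRel.valuation F (h : Matrix (Fin 2) (Fin 2) F).det ≤ 1 := by
      intro h hh
      by_contra hlt
      rw [not_le] at hlt
      obtain ⟨n, hn⟩ := MulArchimedean.arch γ hlt
      have h1 := hγ _ ⟨_, pow_mem hh (n + 1), rfl⟩
      beta_reduce at h1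
      rw [Units.val_pow_eq_pow_val, Matrix.det_pow, map_pow] at h1
      exact absurd (h1.trans hn) (not_le.2 (pow_lt_pow_right₀ hlt (Nat.lt_succ_self n)))
    have hinv : ∀ h : GL (Fin 2) F, ValuativeRel.valuation F (h : Matrix (Fin 2) (Fin 2) F).det *
        ValuativeRel.valuation F ((h⁻¹ : GL (Fin 2) F) : Matrix (Fin 2) (Fin 2) F).det = 1 := fun h => by
      rw [← map_mul, ← Matrix.det_mul, Units.mul_inv, Matrix.det_one, map_one]
    have hconj : ∀ h : GL (Fin 2) F,
        ValuativeRel.valuation F ((g₀⁻¹ * h * g₀ : GL (Fin 2) F) : Matrix (Fin 2) (Fin 2) F).det =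
          ValuativeRel.valuation F (h : Matrix (Fin 2) (Fin 2) F).det := fun h => by
      rw [Units.val_mul, Units.val_mul, Matrix.det_mul, Matrix.det_mul, map_mul, map_mul,
        mul_right_comm, mul_comm (ValuativeRel.valuation F _) (ValuativeRel.valuation F (g₀ : Matrix (Fin 2) (Fin 2) F).det), hinv, one_mul]
    have key : ∀ h ∈ H, ∀ c : Fˣ, h • L.toSubmodule = c • L.toSubmodule → 1 ≤ ValuativeRel.valuation F (c : F) := by
      intro h hh c hc
      have h1 : ValuativeRel.valuation F (h : Matrix (Fin 2) (Fin 2) F).det = 1 := by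
        refine le_antisymm (hle h hh) ?_
        rw [← hinv h]
        exact mul_le_of_le_one_right' (hle _ (inv_mem hh))
      have h2 : (g₀⁻¹ * h * g₀) • (stdSub : Submodule 𝒪[F] (Fin 2 → F)) = c • stdSub := by
        rw [mul_smul, mul_smul, inv_smul_eq_iff, ← hL, hc, hL, smul_scalar_comm]
      have h3 := val_det_le h2
      rw [hconj, h1] at h3
      by_contra hlt
      exact absurd h3 (not_le.2 (pow_lt_one₀ zero_le (not_le.1 hlt) two_ne_zero))
    obtain ⟨c, hc⟩ := toVertex_eq_iff.1 (hfix g hg).symm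
    have hc' : g • L.toSubmodule = c • L.toSubmodule := hc
    have hci : g⁻¹ • L.toSubmodule = c⁻¹ • L.toSubmodule := by
      rw [inv_smul_eq_iff, smul_scalar_comm, hc', inv_smul_smul]
    have k1 := key g hg c hc'
    have k2 := key _ (inv_mem hg) _ hci
    have k3 : ValuativeRel.valuation F (c : F) * ValuativeRel.valuation F ((c⁻¹ : Fˣ) : F) = 1 := by rw [← map_mul, Units.mul_inv, map_one]
    refine mem_K_of_lattice.2 (hc'.trans ?_)
    have hcle : ∀ d : Fˣ, ValuativeRel.valuation F (d : F) ≤ 1 → d • L.toSubmodule ≤ L.toSubmodule := by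
      rintro d hd _ ⟨w, hw, rfl⟩
      exact L.toSubmodule.smul_mem (⟨d, hd⟩ : 𝒪[F]) hw
    refine le_antisymm (hcle c ?_) ?_
    · rw [← k3]; exact le_mul_of_one_le_right' k2
    · have h4 : c⁻¹ • L.toSubmodule ≤ L.toSubmodule :=
        hcle c⁻¹ (by rw [← k3]; exact le_mul_of_one_le_left' k1)
      have h5 : c • c⁻¹ • L.toSubmodule ≤ c • L.toSubmodule := Submodule.map_mono h4
      rwa [smul_inv_smul] at h5

/-- A subgroup `H` of a (totally disconnected) topological group is a pro-`p`-group: it is compact,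
and its quotients by open normal subgroups are `p`-groups. -/
def IsProP (p : ℕ) {G : Type*} [Group G] [TopologicalSpace G] (H : Subgroup G) : Prop :=
  IsCompact (H : Set G) ∧
    ∀ N : Subgroup H, N.Normal → IsOpen (N : Set H) → ∀ h : H, ∃ n : ℕ, h ^ p ^ n ∈ N

theorem conj_mem_U1 {x : Vertex F} {k u : GL (Fin 2) F} (hk : k ∈ K x) (hu : u ∈ U1 x) :
    k * u * k⁻¹ ∈ U1 x := by
  refine ⟨mul_mem (mul_mem hk hu.1) (inv_mem hk), fun L hL w hw => ?_⟩
  have h1 : k⁻¹ • w ∈ L.toSubmodule := by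
    have h3 := (inv_mem hk) L hL
    exact h3 ▸ Submodule.smul_mem_pointwise_smul _ k⁻¹ _ hw
  have h4 : k • (𝓂[F] • L.toSubmodule) = 𝓂[F] • L.toSubmodule := by
    rw [smul_maximalIdeal_smul, hk L hL]
  have h2 : k • (u • k⁻¹ • w - k⁻¹ • w) ∈ 𝓂[F] • L.toSubmodule :=
    h4 ▸ Submodule.smul_mem_pointwise_smul _ k _ (hu.2 L hL _ h1)
  rw [smul_sub, smul_inv_smul] at h2
  rwa [mul_smul, mul_smul]

theorem natCast_lt_one (p : ℕ) [CharP 𝓀[F] p] : ValuativeRel.valuation F (p : F) < 1 := by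
  have h1 : IsLocalRing.residue 𝒪[F] (p : 𝒪[F]) = 0 := by
    rw [map_natCast]; exact CharP.cast_eq_zero _ p
  have h2 := Valuation.Integer.not_isUnit_iff_valuation_lt_one.1
    ((IsLocalRing.residue_eq_zero_iff _).1 h1)
  simpa using h2

theorem trace_eq_two {k : Type*} [Field k] (p : ℕ) [Fact p.Prime] [CharP k p]
    {B : Matrix (Fin 2) (Fin 2) k} {n : ℕ} (hB : B ^ p ^ n = 1) :
    B 0 0 + B 1 1 = 2 ∧ (B 0 0 - 1) * (B 1 1 - 1) = B 0 1 * B 1 0 := by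
  have h0 : (B - 1) ^ p ^ n = 0 := by
    rw [sub_pow_char_pow_of_commute p n (Commute.one_right B), hB, one_pow, sub_self]
  have hnil : IsNilpotent (B - 1) := ⟨_, h0⟩
  have ht := (Matrix.isNilpotent_trace_of_isNilpotent hnil).eq_zero
  have hd : (B - 1).det = 0 := by
    have := congrArg Matrix.det h0
    rw [Matrix.det_pow, Matrix.det_zero] at this
    exact pow_eq_zero_iff (pow_ne_zero n (Fact.out : p.Prime).ne_zero) |>.1 this
  rw [Matrix.trace_fin_two] at ht
  rw [Matrix.det_fin_two] at hd
  simp only [Matrix.sub_apply, Matrix.one_apply_eq, ne_eq, zero_ne_one, not_false_eq_true,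
    Matrix.one_apply_ne, one_ne_zero, sub_zero] at ht hd
  exact ⟨by linear_combination ht, by linear_combination hd⟩

/-- `U_x^{(1)}` is the maximal normal pro-`p`-subgroup of `K_x`. -/
theorem isGreatest_U1 (p : ℕ) [Fact p.Prime] [CharP 𝓀[F] p] (x : Vertex F) :
    IsGreatest {P : Subgroup (GL (Fin 2) F) |
      P ≤ K x ∧ (P.subgroupOf (K x)).Normal ∧ IsProP p P} (U1 x) := by
  induction x using Quotient.inductionOn with
  | h L =>
  change IsGreatest {P : Subgroup (GL (Fin 2) F) | P ≤ K L.toVertex ∧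
    (P.subgroupOf (K L.toVertex)).Normal ∧ IsProP p P} (U1 L.toVertex)
  obtain ⟨g₀, hL⟩ := exists_frame L
  obtain ⟨π, h1, h0, hπ⟩ := exists_unif (F := F)
  have hp : ValuativeRel.valuation F (p : F) ≤ ValuativeRel.valuation F π := hπ _ (natCast_lt_one p)
  have hU : ∀ {g : GL (Fin 2) F}, g ∈ U1 L.toVertex ↔ g₀⁻¹ * g * g₀ ∈ smallGL (ValuativeRel.valuation F π) :=
    mem_U1_frame' hL h1 hπ
  have hcont : Continuous fun g : GL (Fin 2) F => g₀⁻¹ * g * g₀ :=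
    (continuous_const.mul continuous_id).mul continuous_const
  have hopen : IsOpen (U1 L.toVertex : Set (GL (Fin 2) F)) := by
    refine Subgroup.isOpen_of_mem_nhds _ (g := 1) ?_
    have := hcont.tendsto 1
    simp only [mul_one, inv_mul_cancel] at this
    exact Filter.mem_of_superset (this (smallGL_mem_nhds h0)) fun g hg => hU.2 hg
  constructor
  · refine ⟨fun g hg => hg.1, ⟨fun u hu k => conj_mem_U1 k.2 hu⟩, ?_, fun N _ hN h => ?_⟩
    · have : (U1 L.toVertex : Set (GL (Fin 2) F)) =
          (fun g => g₀ * g * g₀⁻¹) '' smallGL (ValuativeRel.valuation F π) := by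
        ext g
        constructor
        · intro hg
          exact ⟨_, hU.1 hg, by group⟩
        · rintro ⟨h, hh, rfl⟩
          refine hU.2 ?_
          convert hh using 1
          group
      rw [this]
      exact (isCompact_smallGL _).image
        ((continuous_const.mul continuous_id).mul continuous_const)
    · have hlim := tendsto_pow_of_smallGL h1 hp (hU.1 h.2)
      have hlim2 : Filter.Tendsto (fun n : ℕ => (h : GL (Fin 2) F) ^ p ^ n) Filter.atTop
          (nhds 1) := by
        have hc2 : Continuous fun g : GL (Fin 2) F => g₀ * g * g₀⁻¹ :=
          (continuous_const.mul continuous_id).mul continuous_const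
        have := (hc2.tendsto 1).comp hlim
        simp only [mul_one, mul_inv_cancel] at this
        refine this.congr fun n => ?_
        have hc : g₀⁻¹ * (h : GL (Fin 2) F) * g₀ = MulAut.conj g₀⁻¹ (h : GL (Fin 2) F) := by
          simp
        simp only [Function.comp_apply]
        rw [hc, ← map_pow, MulAut.conj_apply]
        group
      have hlim3 : Filter.Tendsto (fun n : ℕ => h ^ p ^ n) Filter.atTop (nhds 1) :=
        tendsto_subtype_rng.2 hlim2
      exact (hlim3.eventually (hN.mem_nhds (one_mem N))).exists
  · rintro P ⟨hPK, hPn, -, hP⟩ g hg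
    have hpow : ∀ h ∈ P, ∃ n : ℕ, h ^ p ^ n ∈ U1 L.toVertex := fun h hh =>
      hP ((U1 L.toVertex).subgroupOf P)
        ⟨fun u hu k => conj_mem_U1 (hPK k.2) hu⟩ (hopen.preimage continuous_subtype_val) ⟨h, hh⟩
    let ι : Matrix (Fin 2) (Fin 2) 𝒪[F] →+* Matrix (Fin 2) (Fin 2) F := (𝒪[F].subtype).mapMatrix
    let r : Matrix (Fin 2) (Fin 2) 𝒪[F] →+* Matrix (Fin 2) (Fin 2) 𝓀[F] :=
      (IsLocalRing.residue 𝒪[F]).mapMatrix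
    have hr : ∀ A : Matrix (Fin 2) (Fin 2) 𝒪[F],
        (∀ i j, ValuativeRel.valuation F (ι A i j - (1 : Matrix (Fin 2) (Fin 2) F) i j) < 1) ↔ r A = 1 := by
      intro A
      rw [← Matrix.ext_iff]
      refine forall_congr' fun i => forall_congr' fun j => ?_
      rw [← sub_eq_zero (b := (1 : Matrix (Fin 2) (Fin 2) 𝓀[F]) i j), ← map_one r, ← map_one ι]
      change ValuativeRel.valuation F (((A i j - (1 : Matrix (Fin 2) (Fin 2) 𝒪[F]) i j : 𝒪[F]) : F)) < 1 ↔
        IsLocalRing.residue 𝒪[F] (A i j) - IsLocalRing.residue 𝒪[F]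
          ((1 : Matrix (Fin 2) (Fin 2) 𝒪[F]) i j) = 0
      rw [← map_sub, IsLocalRing.residue_eq_zero_iff]
      exact Valuation.Integer.not_isUnit_iff_valuation_lt_one.symm
    have htr : ∀ h ∈ P, ∀ H : Matrix (Fin 2) (Fin 2) 𝒪[F],
        ι H = (g₀⁻¹ * h * g₀ : GL (Fin 2) F) →
        r H 0 0 + r H 1 1 = 2 ∧ (r H 0 0 - 1) * (r H 1 1 - 1) = r H 0 1 * r H 1 0 := by
      intro h hh H hH
      obtain ⟨n, hn⟩ := hpow h hh
      refine trace_eq_two p (n := n) ?_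
      rw [← map_pow]
      refine (hr _).1 fun i j => ?_
      have h2 := ((mem_U1_frame hL).1 hn).2 i j
      have hc : g₀⁻¹ * h ^ p ^ n * g₀ = (g₀⁻¹ * h * g₀) ^ p ^ n := by
        have hc' : ∀ m : GL (Fin 2) F, g₀⁻¹ * m * g₀ = MulAut.conj g₀⁻¹ m := by
          simp
        rw [hc', hc', map_pow]
      rw [hc, Units.val_pow_eq_pow_val, ← hH, ← map_pow] at h2
      exact h2
    have hgK := (mem_K_frame hL).1 (hPK hg)
    let H : Matrix (Fin 2) (Fin 2) 𝒪[F] := Matrix.of fun i j => ⟨_, hgK.1 i j⟩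
    have hH : ι H = (g₀⁻¹ * g * g₀ : GL (Fin 2) F) := rfl
    have hconj : ∀ E E' : Matrix (Fin 2) (Fin 2) 𝒪[F], E * E' = 1 → E' * E = 1 →
        r (H * (E * H * E')) 0 0 + r (H * (E * H * E')) 1 1 = 2 := by
      intro E E' h3 h4
      let ε : GL (Fin 2) F := ⟨ι E, ι E', by rw [← map_mul, h3, map_one],
        by rw [← map_mul, h4, map_one]⟩
      let k : GL (Fin 2) F := g₀ * ε * g₀⁻¹
      have hk' : g₀⁻¹ * k * g₀ = ε := by simp only [k]; group
      have hk : k ∈ K L.toVertex := by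
        refine (mem_K_frame hL).2 ?_
        rw [hk']
        exact ⟨fun i j => (E i j).2, fun i j => (E' i j).2⟩
      have hm : g * (k * g * k⁻¹) ∈ P := mul_mem hg (hPn.conj_mem ⟨g, hPK hg⟩ hg ⟨k, hk⟩)
      refine (htr _ hm _ ?_).1
      have e1 : g₀⁻¹ * (g * (k * g * k⁻¹)) * g₀ =
          (g₀⁻¹ * g * g₀) * (ε * (g₀⁻¹ * g * g₀) * ε⁻¹) := by
        rw [← hk']; group
      rw [e1, map_mul, map_mul, map_mul, hH]
      rfl
    have t0 := htr g hg H hH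
    have t1 := hconj !![1, 1; 0, 1] !![1, -1; 0, 1] (by simp [Matrix.one_fin_two])
      (by simp [Matrix.one_fin_two])
    have t2 := hconj !![1, 0; 1, 1] !![1, 0; -1, 1] (by simp [Matrix.one_fin_two])
      (by simp [Matrix.one_fin_two])
    have e1 : r !![1, 1; 0, 1] = !![1, 1; 0, 1] := by
      ext i j; fin_cases i <;> fin_cases j <;> simp [r]
    have e2 : r !![1, -1; 0, 1] = !![1, -1; 0, 1] := by
      ext i j; fin_cases i <;> fin_cases j <;> simp [r]
    have e3 : r !![1, 0; 1, 1] = !![1, 0; 1, 1] := by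
      ext i j; fin_cases i <;> fin_cases j <;> simp [r]
    have e4 : r !![1, 0; -1, 1] = !![1, 0; -1, 1] := by
      ext i j; fin_cases i <;> fin_cases j <;> simp [r]
    rw [map_mul, map_mul, map_mul, e1, e2] at t1
    rw [map_mul, map_mul, map_mul, e3, e4] at t2
    refine (mem_U1_frame hL).2 ⟨hPK hg, (hr H).2 ?_⟩
    generalize r H = B at *
    rw [Matrix.eta_fin_two B] at t1 t2 ⊢
    simp only [Matrix.mul_fin_two, Matrix.of_apply, Matrix.cons_val_zero, Matrix.cons_val_one,
      Matrix.cons_val', Matrix.cons_val_fin_one] at t1 t2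
    obtain ⟨u1, u2⟩ := t0
    have c0 : B 1 0 = 0 := by
      refine pow_eq_zero_iff (two_ne_zero) |>.1 ?_
      linear_combination -t1 + (B 0 0 + B 1 1 + 2) * u1 - 2 * u2 - 2 * u1
    have b0 : B 0 1 = 0 := by
      refine pow_eq_zero_iff (two_ne_zero) |>.1 ?_
      linear_combination -t2 + (B 0 0 + B 1 1 + 2) * u1 - 2 * u2 - 2 * u1
    have a0 : B 0 0 = 1 := by
      have : B 0 0 - 1 = 0 := by
        refine pow_eq_zero_iff (two_ne_zero) |>.1 ?_
        linear_combination (B 0 0 - 1) * u1 - u2 - B 1 0 * b0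
      linear_combination this
    have d0 : B 1 1 = 1 := by linear_combination u1 - a0
    rw [a0, b0, c0, d0, Matrix.one_fin_two]

end ProP
end BTTree

/-! ### Reduction to a statement about groups -/

namespace HeckeAction

variable {Λ : Type*} [CommRing Λ] {G : Type*} [Group G]
  {V : Type*} [AddCommGroup V] [Module Λ V]

/-! Write U and Û for the two groups attached to the edge σ. For a Hecke operator `T` put f =
T(1_U), a finitely supported U-invariant function on U\G, so that v·T = ∑ f(t) t⁻¹v. The group Û
does not act on U\G, but it acts on V. Pushing f forward along t ↦ t⁻¹v gives a finitely supported
U-invariant function S on V, supported in the orbit Gv, and v·T is the sum of S(w)w over all w. If v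
is Û-fixed, it is therefore enough that each n ∈ Û moves every hv, h ∈ G, in the same way as some u
∈ U does. This is so as soon as h⁻¹u⁻¹nh ∈ Û. That is `heckeAct_mem_fixedVectors`, which is pure
group theory.

To find u (`exists_mem_UE_conj_mem_Uhat`), use the definition of Û at the edge hσ: some u ∈ U agrees
with n on Z^(e)(hσ), so w = h⁻¹u⁻¹nh is locally algebraic and trivial on Z^(e)(σ). The heart of the
proof is that such a w lies in Û (`mem_locallyIn_UE_of_fixes_ballE`).

This is shown by propagation along a ray a₀, a₁, a₂, … starting with σ = {a₀, a₁}
(`exists_mem_UE_of_frame`). Suppose w agrees with u ∈ U around one edge of the ray and with h ∈ G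
around the next. Then u⁻¹h fixes the e-ball about the common vertex. In coordinates where that
vertex is 𝒪² and the ray continues with 𝒪 ⊕ πᵏ𝒪, this forces u⁻¹h to be a scalar times a matrix
congruent to 1 modulo πᵉ (`exists_scalar_of_fixes_ballV`). Such a matrix is a lower unipotent times
an upper triangular one (`exists_eq_lowerGL_mul`). The upper triangular factor acts trivially around
the new edge, so it can be dropped. The lower unipotent factor, rewritten in coordinates centred at
a₁, only becomes more congruent to 1, so it lies in the generator U_{a₁}^(e) of U. Hence u can be
corrected inside U.

Every edge lies on such a ray (`exists_pointsAwayFrom` and `PointsAwayFrom.eq_or_pointsAwayFrom`),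
by the explicit list of neighbours of 𝒪² in `eq_of_adj_stdVertex`. Of the graph X only connectedness
and this list are used, not acyclicity. -/

theorem cosetVec_shift (ρ : Representation Λ G V) (U : Subgroup G) (v : fixedVectors ρ U) (g : G)
    (t : RightCosets U) : cosetVec ρ U v (shift U g t) = ρ g (cosetVec ρ U v t) := by
  induction t using Quotient.inductionOn with
  | h x =>
    change ρ (x * g⁻¹)⁻¹ (v : V) = ρ g (ρ x⁻¹ (v : V))
    rw [mul_inv_rev, inv_inv, map_mul, Module.End.mul_apply]

/-- This is what makes the Hecke module structure compatible with the given `Λ`-module structure. -/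
theorem op_algebraMap_smul (ρ : Representation Λ G V) (U : Subgroup G) (a : Λ)
    (v : fixedVectors ρ U) : MulOpposite.op (algebraMap Λ (Hecke Λ U) a) • v = a • v := by
  refine Subtype.ext ?_
  change frob ρ U v (a • charU Λ U) = _
  rw [map_smul, frob_charU]
  rfl

/-- If `N` is a subgroup of an overgroup of `G` whose orbits on the translates of an `N`-fixed
vector are already `U`-orbits, then the Hecke algebra of `U` preserves the `N`-fixed vectors. -/
theorem heckeAct_mem_fixedVectors {H : Type*} [Group H] (ρ : Representation Λ H V) (ι : G →* H)
    {U : Subgroup G} {N : Subgroup H}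
    (hN : ∀ n ∈ N, ∀ h : G, ∃ u ∈ U, (ι h)⁻¹ * (ι u)⁻¹ * n * ι h ∈ N)
    (v : fixedVectors (ρ.comp ι) U) (hv : (v : V) ∈ fixedVectors ρ N) (T : Hecke Λ U) :
    (heckeAct (ρ.comp ι) U v T : V) ∈ fixedVectors ρ N := by
  set φ := cosetVec (ρ.comp ι) U v with hφ
  set f := (T : Module.End Λ (CInd Λ U)) (charU Λ U) with hf
  -- `N` does not act on `RightCosets U`, but it acts on `V`. Invariance is therefore tested on the
  -- push-forward of `f`.
  set S : V →₀ Λ := Finsupp.mapDomain φ f with hS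
  have hact : ((heckeAct (ρ.comp ι) U v T : fixedVectors (ρ.comp ι) U) : V) =
      Finsupp.linearCombination Λ id S := by
    rw [hS, Finsupp.linearCombination_mapDomain]
    rfl
  have hinj : ∀ h : H, Function.Injective (ρ h) := fun h =>
    Function.LeftInverse.injective (g := ρ h⁻¹) fun w => by
      rw [← Module.End.mul_apply, ← map_mul, inv_mul_cancel, map_one, Module.End.one_apply]
  have hU : ∀ u ∈ U, ∀ w, S (ρ (ι u) w) = S w := by
    intro u hu w
    have h1 : cIndRep Λ U u f = f := by
      rw [hf, ← Hecke.comm]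
      congr 1
      rw [charU, cIndRep_single,
        coset_eq_iff.2 (show (1 : G) * (1 * u⁻¹)⁻¹ ∈ U by simpa using hu)]
    have h2 : Finsupp.mapDomain (ρ (ι u)) S = S := by
      have h3 : (ρ (ι u) : V → V) ∘ φ = φ ∘ shift U u := by
        funext t
        exact (cosetVec_shift (ρ.comp ι) U v u t).symm
      rw [hS, ← Finsupp.mapDomain_comp, h3, Finsupp.mapDomain_comp]
      congr 1
    conv_lhs => rw [← h2]
    exact Finsupp.mapDomain_apply (hinj _) S w
  -- The hypothesis `hN` only controls the orbit of `v`, so invariance is first shown at points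
  -- where `S` is nonzero. These lie in the range of `φ`.
  have hsupp : ∀ n ∈ N, ∀ w, S w ≠ 0 → S (ρ n w) = S w := by
    intro n hn w hw
    have hmem : w ∈ Set.range φ := by
      by_contra hw'
      exact hw (Finsupp.mapDomain_of_notMem_range f w hw')
    obtain ⟨t, rfl⟩ := hmem
    induction t using Quotient.inductionOn with
    | h x =>
    -- The element of `G` is `x⁻¹`, because `φ` sends the coset of `x` to `x⁻¹ v`.
    obtain ⟨u, hu, hn'⟩ := hN n hn x⁻¹
    have h1 := mem_fixedVectors.1 hv _ hn'
    have h2 : ρ n (ρ (ι x⁻¹) (v : V)) = ρ (ι u) (ρ (ι x⁻¹) (v : V)) := by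
      conv_rhs => rw [← h1]
      simp only [← Module.End.mul_apply, ← map_mul]
      congr 2
      group
    change S (ρ n (ρ (ι x⁻¹) (v : V))) = _
    rw [h2, hU u hu]
    rfl
  have hall : ∀ n ∈ N, ∀ w, S (ρ n w) = S w := by
    intro n hn w
    by_cases hw : S w = 0
    · by_contra hne
      -- Off the support, apply the previous case to `n⁻¹` at the point `ρ n w`.
      have h1 := hsupp n⁻¹ (inv_mem hn) (ρ n w) (by rwa [hw] at hne)
      rw [← Module.End.mul_apply, ← map_mul, inv_mul_cancel, map_one, Module.End.one_apply] at h1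
      exact hne h1.symm
    · exact hsupp n hn w hw
  refine mem_fixedVectors.2 fun n hn => ?_
  have h1 : Finsupp.mapDomain (ρ n) S = S := by
    ext w
    obtain ⟨w, rfl⟩ : ∃ w', ρ n w' = w := ⟨ρ n⁻¹ w, by
      rw [← Module.End.mul_apply, ← map_mul, mul_inv_cancel, map_one, Module.End.one_apply]⟩
    rw [Finsupp.mapDomain_apply (hinj n), hall n hn]
  calc ρ n (heckeAct (ρ.comp ι) U v T : V)
      = Finsupp.linearCombination Λ (ρ n ∘ id) S := by
        rw [hact, Finsupp.apply_linearCombination]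
    _ = Finsupp.linearCombination Λ id (Finsupp.mapDomain (ρ n) S) := by
        rw [Finsupp.linearCombination_mapDomain _ (⇑(ρ n)) S]
        rfl
    _ = heckeAct (ρ.comp ι) U v T := by rw [h1, hact]

end HeckeAction

/-! ### Explicit matrices, and lattices in F² -/

namespace BTTree

section Matrices

open Matrix

variable {F : Type*} [Field F]

/-- The diagonal matrix `diag(1, t)`. -/
def diagGL (t : Fˣ) : GL (Fin 2) F where
  val := !![1, 0; 0, (t : F)]
  inv := !![1, 0; 0, ((t⁻¹ : Fˣ) : F)]
  val_inv := by simp [Matrix.one_fin_two]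
  inv_val := by simp [Matrix.one_fin_two]

/-- The lower unipotent matrix with lower left entry `c`. -/
def lowerGL (c : F) : GL (Fin 2) F where
  val := !![1, 0; c, 1]
  inv := !![1, 0; -c, 1]
  val_inv := by simp [Matrix.one_fin_two]
  inv_val := by simp [Matrix.one_fin_two]

variable (F) in
/-- The permutation matrix of the transposition. -/
def swapGL : GL (Fin 2) F where
  val := !![0, 1; 1, 0]
  inv := !![0, 1; 1, 0]
  val_inv := by simp [Matrix.one_fin_two]
  inv_val := by simp [Matrix.one_fin_two]

/-- The scalar matrix `c`. -/
abbrev scalarGL (c : Fˣ) : GL (Fin 2) F := Matrix.GeneralLinearGroup.scalar (Fin 2) c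

theorem scalarGL_smul (c : Fˣ) (w : Fin 2 → F) : scalarGL c • w = c • w := by
  rw [toMatrix_smul]
  change Matrix.scalar (Fin 2) (c : F) *ᵥ w = c • w
  funext i
  simp [Units.smul_def]

theorem scalarGL_mul (c d : Fˣ) : scalarGL (c * d) = scalarGL c * scalarGL d := map_mul _ c d

theorem scalarGL_mul_apply (c : Fˣ) (g : GL (Fin 2) F) (i j : Fin 2) :
    ((scalarGL c * g : GL (Fin 2) F) : Matrix (Fin 2) (Fin 2) F) i j =
      (c : F) * (g : Matrix (Fin 2) (Fin 2) F) i j := by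
  rw [Units.val_mul]
  change (Matrix.scalar (Fin 2) (c : F) * (g : Matrix (Fin 2) (Fin 2) F)) i j = _
  simp

theorem diagGL_one : diagGL (1 : Fˣ) = 1 := Units.ext (by simp [diagGL, Matrix.one_fin_two])

theorem lowerGL_zero : lowerGL (0 : F) = 1 := Units.ext (by simp [lowerGL, Matrix.one_fin_two])

theorem lowerGL_inv (c : F) : (lowerGL c)⁻¹ = lowerGL (-c) := by
  refine Units.ext ?_
  simp [lowerGL, Units.inv_mk]

theorem diagGL_inv (t : Fˣ) : (diagGL t)⁻¹ = diagGL t⁻¹ := by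
  refine Units.ext ?_
  simp [diagGL, Units.inv_mk]

theorem diagGL_mul (s t : Fˣ) : diagGL (s * t) = diagGL s * diagGL t := by
  refine Units.ext ?_
  simp [diagGL]

theorem swapGL_inv : (swapGL F)⁻¹ = swapGL F := Units.ext rfl

/-- For a uniformizer `t` this is a contraction: moving the base point along the ray 𝒪 ⊕ πᵏ𝒪
rescales lower unipotents by powers of π. The propagation argument rests on it. -/
theorem diagGL_conj_lowerGL (t : Fˣ) (c : F) :
    diagGL t * lowerGL c * (diagGL t)⁻¹ = lowerGL ((t : F) * c) := by
  rw [diagGL_inv]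
  refine Units.ext ?_
  simp [diagGL, lowerGL]

/-- As scalars act trivially on vertices, the transposition reverses the standard apartment. -/
theorem swapGL_conj_diagGL (t : Fˣ) :
    swapGL F * diagGL t * swapGL F = scalarGL t * diagGL t⁻¹ := by
  refine Units.ext ?_
  ext i j
  fin_cases i <;> fin_cases j <;>
    simp [swapGL, diagGL]

end Matrices

section Lattices

open ValuativeRel (valuation)
open Matrix

variable {F : Type*} [Field F] [ValuativeRel F]

theorem mem_gl_smul {g : GL (Fin 2) F} {L : Submodule 𝒪[F] (Fin 2 → F)} {w : Fin 2 → F} :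
    w ∈ g • L ↔ g⁻¹ • w ∈ L := by
  constructor
  · rintro ⟨u, hu, rfl⟩
    change g⁻¹ • g • u ∈ L
    rwa [inv_smul_smul]
  · intro h
    exact ⟨_, h, smul_inv_smul g w⟩

theorem mem_unit_smul {c : Fˣ} {L : Submodule 𝒪[F] (Fin 2 → F)} {w : Fin 2 → F} :
    w ∈ c • L ↔ (c⁻¹ : Fˣ) • w ∈ L := by
  constructor
  · rintro ⟨u, hu, rfl⟩
    change c⁻¹ • c • u ∈ L
    rwa [inv_smul_smul]
  · intro h
    exact ⟨_, h, smul_inv_smul c w⟩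

theorem smul_mem_of_valuation_le {L : Submodule 𝒪[F] (Fin 2 → F)} {w : Fin 2 → F} (hw : w ∈ L)
    {a : F} (ha : valuation F a ≤ 1) : a • w ∈ L := L.smul_mem (⟨a, ha⟩ : 𝒪[F]) hw

theorem unit_smul_mono (c : Fˣ) {L M : Submodule 𝒪[F] (Fin 2 → F)} (h : L ≤ M) : c • L ≤ c • M :=
  Submodule.map_mono h

theorem gl_smul_mono (g : GL (Fin 2) F) {L M : Submodule 𝒪[F] (Fin 2 → F)} (h : L ≤ M) :
    g • L ≤ g • M :=
  Submodule.map_mono h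

/-- A lattice mapped into itself by `g` and `g⁻¹` is stable under `g`. -/
theorem gl_smul_eq_of_forall_mem {g : GL (Fin 2) F} {L : Submodule 𝒪[F] (Fin 2 → F)}
    (h : ∀ w ∈ L, g • w ∈ L) (h' : ∀ w ∈ L, g⁻¹ • w ∈ L) : g • L = L := by
  refine le_antisymm ?_ fun w hw => mem_gl_smul.2 (h' w hw)
  rintro _ ⟨w, hw, rfl⟩
  exact h w hw

theorem single_mem_stdSub (j : Fin 2) :
    (Pi.single j 1 : Fin 2 → F) ∈ (stdSub : Submodule 𝒪[F] (Fin 2 → F)) := fun k => by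
  by_cases hk : k = j
  · subst hk; simp
  · simp [hk]

variable (F) in
/-- The lattice `𝒪²`. -/
def stdLattice : Lattice F where
  toSubmodule := stdSub
  isLattice := by
    have hspan : (stdSub : Submodule 𝒪[F] (Fin 2 → F)) =
        Submodule.span 𝒪[F] (Set.range fun j : Fin 2 => (Pi.single j 1 : Fin 2 → F)) := by
      refine le_antisymm (fun w hw => ?_) (Submodule.span_le.2 ?_)
      · have h : w = (⟨w 0, hw 0⟩ : 𝒪[F]) • (Pi.single 0 1 : Fin 2 → F) +
            (⟨w 1, hw 1⟩ : 𝒪[F]) • (Pi.single 1 1 : Fin 2 → F) := by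
          funext i
          change w i = w 0 * _ + w 1 * _
          fin_cases i <;> simp
        rw [h]
        exact add_mem (Submodule.smul_mem _ _ (Submodule.subset_span ⟨0, rfl⟩))
          (Submodule.smul_mem _ _ (Submodule.subset_span ⟨1, rfl⟩))
      · rintro _ ⟨j, rfl⟩
        exact single_mem_stdSub j
    refine ⟨?_, ?_⟩
    · rw [hspan]
      exact Submodule.fg_span (Set.finite_range _)
    · refine eq_top_iff.2 fun w _ => ?_
      have h : w = w 0 • (Pi.single 0 1 : Fin 2 → F) + w 1 • (Pi.single 1 1 : Fin 2 → F) := by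
        funext i
        fin_cases i <;> simp
      rw [h]
      exact add_mem (Submodule.smul_mem _ _ (Submodule.subset_span (single_mem_stdSub 0)))
        (Submodule.smul_mem _ _ (Submodule.subset_span (single_mem_stdSub 1)))

variable (F) in
/-- The vertex of the tree given by `𝒪²`. -/
def stdVertex : Vertex F := (stdLattice F).toVertex

theorem stdVertex_eq_of_lattice {g : GL (Fin 2) F} :
    g • stdVertex F = stdVertex F ↔
      ∃ c : Fˣ, g • (stdSub : Submodule 𝒪[F] (Fin 2 → F)) = c • stdSub := by
  rw [eq_comm]
  exact toVertex_eq_iff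

theorem scalarGL_smul_submodule (c : Fˣ) (L : Submodule 𝒪[F] (Fin 2 → F)) :
    scalarGL c • L = c • L := by
  ext w
  rw [mem_gl_smul, mem_unit_smul, ← map_inv, scalarGL_smul]

theorem scalarGL_smul_vertex (c : Fˣ) (x : Vertex F) : scalarGL c • x = x := by
  induction x using Quotient.inductionOn with
  | h L =>
    exact (toVertex_eq_iff.2 ⟨c, scalarGL_smul_submodule c L.1⟩).symm

theorem dist_smul (g : GL (Fin 2) F) (x y : Vertex F) :
    (tree F).dist (g • x) (g • y) = (tree F).dist x y :=
  toPerm_mem_treeAut g x y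

theorem smul_eq_of_mem_K {g : GL (Fin 2) F} {x : Vertex F} (hg : g ∈ K x) : g • x = x := by
  induction x using Quotient.inductionOn with
  | h L => exact congrArg Lattice.toVertex (Lattice.ext (hg L rfl))

end Lattices
end BTTree

/-! ### Adjacency in terms of lattices, and connectedness of the tree -/

namespace BTTree

section Neighbours

open ValuativeRel (valuation)
open Matrix

variable {F : Type*} [Field F] [ValuativeRel F]

/-- A uniformizer, as a unit of `F`. -/
def IsUniformizer (π : Fˣ) : Prop :=
  ∀ x : F, valuation F x < 1 ↔ valuation F x ≤ valuation F (π : F)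

theorem valuation_unit_ne_zero (c : Fˣ) : valuation F (c : F) ≠ 0 :=
  (Valuation.ne_zero_iff _).2 c.ne_zero

theorem valuation_unit_inv (c : Fˣ) :
    valuation F ((c⁻¹ : Fˣ) : F) = (valuation F (c : F))⁻¹ := by
  rw [Units.val_inv_eq_inv_val, map_inv₀]

theorem unit_smul_le_unit_smul {c d : Fˣ} (h : valuation F (c : F) ≤ valuation F (d : F))
    (L : Submodule 𝒪[F] (Fin 2 → F)) : c • L ≤ d • L := by
  intro w hw
  rw [mem_unit_smul] at hw ⊢
  have h1 : d⁻¹ • w = (((d⁻¹ * c : Fˣ) : F)) • (c⁻¹ • w) := by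
    rw [← Units.smul_def, smul_smul]
    congr 1
    group
  rw [h1]
  refine smul_mem_of_valuation_le hw ?_
  rw [Units.val_mul, map_mul, valuation_unit_inv]
  exact (inv_mul_le_iff₀ (zero_lt_iff.2 (valuation_unit_ne_zero d))).2 (by rwa [mul_one])

theorem unit_smul_lt (c : Fˣ) {L M : Submodule 𝒪[F] (Fin 2 → F)} (h : L < M) : c • L < c • M :=
  lt_of_le_of_ne (unit_smul_mono c h.le) fun he => h.ne (smul_left_cancel c he)

theorem toVertex_scalarGL_smul (c : Fˣ) (L : Lattice F) :
    (scalarGL c • L).toVertex = L.toVertex := by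
  rw [← smul_toVertex, scalarGL_smul_vertex]

namespace IsUniformizer

variable {π : Fˣ} (hπ : IsUniformizer π)

include hπ

theorem valuation_lt_one : valuation F (π : F) < 1 := (hπ π).2 le_rfl

theorem maximalIdeal_smul (L : Submodule 𝒪[F] (Fin 2 → F)) : 𝓂[F] • L = π • L := by
  refine le_antisymm (Submodule.smul_le.2 fun r hr w hw => ?_) ?_
  · rw [mem_unit_smul]
    have h1 : valuation F (r : F) ≤ valuation F (π : F) :=
      (hπ _).1 (Valuation.Integer.not_isUnit_iff_valuation_lt_one.1 hr)
    have h2 : π⁻¹ • r • w = (((π⁻¹ : Fˣ) : F) * (r : F)) • w := by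
      rw [mul_smul]
      rfl
    rw [h2]
    refine smul_mem_of_valuation_le hw ?_
    rw [map_mul, valuation_unit_inv]
    exact (inv_mul_le_iff₀ (zero_lt_iff.2 (valuation_unit_ne_zero π))).2 (by rwa [mul_one])
  · rintro _ ⟨w, hw, rfl⟩
    have hm : (⟨(π : F), hπ.valuation_lt_one.le⟩ : 𝒪[F]) ∈ 𝓂[F] :=
      Valuation.Integer.not_isUnit_iff_valuation_lt_one.2 hπ.valuation_lt_one
    exact Submodule.smul_mem_smul hm hw

theorem smul_le_self (L : Submodule 𝒪[F] (Fin 2 → F)) : π • L ≤ L := by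
  have := unit_smul_le_unit_smul (c := π) (d := 1)
    (by simpa using hπ.valuation_lt_one.le) L
  rwa [one_smul] at this

/-- The content is that the two vertices are distinct. If M = cL, then c would have valuation
strictly between those of π and 1. -/
theorem adj_of_lt {L M : Lattice F} (h1 : π • L.1 < M.1) (h2 : M.1 < L.1) :
    (tree F).Adj L.toVertex M.toVertex := by
  rw [tree, SimpleGraph.fromRel_adj]
  refine ⟨fun he => ?_, Or.inl ⟨L, M, rfl, rfl, by rwa [hπ.maximalIdeal_smul], h2⟩⟩
  obtain ⟨c, hc⟩ := toVertex_eq_iff.1 he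
  rw [hc] at h1 h2
  rcases lt_or_ge (valuation F (c : F)) 1 with h | h
  · exact absurd h1 (not_lt_of_ge (unit_smul_le_unit_smul ((hπ _).1 h) _))
  · have := unit_smul_le_unit_smul (c := 1) (d := c) (by simpa using h) L.1
    rw [one_smul] at this
    exact absurd h2 (not_lt_of_ge this)

/-- A neighbour of the vertex of a lattice `L` is represented by an intermediate lattice of
`π L ⊆ L`. -/
theorem exists_lattice_of_adj {L : Lattice F} {y : Vertex F} (h : (tree F).Adj L.toVertex y) :
    ∃ M : Lattice F, M.toVertex = y ∧ π • L.1 < M.1 ∧ M.1 < L.1 := by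
  rw [tree, SimpleGraph.fromRel_adj] at h
  have key : ∃ L' M : Lattice F, L'.toVertex = L.toVertex ∧ M.toVertex = y ∧ π • L'.1 < M.1 ∧
      M.1 < L'.1 := by
    rcases h.2 with ⟨L', M, h1, h2, h3, h4⟩ | ⟨M, L', h1, h2, h3, h4⟩
    · exact ⟨L', M, h1, h2, by rwa [hπ.maximalIdeal_smul] at h3, h4⟩
    · rw [hπ.maximalIdeal_smul] at h3
      -- If 𝔪M ⊊ L' ⊊ M is the inclusion at hand, replacing M by πM exchanges the roles of the two
      -- lattices.
      refine ⟨L', scalarGL π • M, h2, (toVertex_scalarGL_smul π M).trans h1, ?_, ?_⟩ <;>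
        rw [coe_smul, scalarGL_smul_submodule]
      · exact unit_smul_lt π h4
      · exact h3
  obtain ⟨L', M, h1, h2, h3, h4⟩ := key
  obtain ⟨c, hc⟩ := toVertex_eq_iff.1 h1
  refine ⟨scalarGL c • M, (toVertex_scalarGL_smul c M).trans h2, ?_, ?_⟩ <;>
    rw [coe_smul, scalarGL_smul_submodule, hc]
  · rw [smul_comm]
    exact unit_smul_lt c h3
  · exact unit_smul_lt c h4

/-- Each step of the walk costs at most one factor π. The walk ends at the vertex of `L`, so that
induction on it removes the edge at `y`. -/
theorem exists_lattice_of_walk {L : Lattice F} {x y : Vertex F} (w : (tree F).Walk y x)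
    (hx : L.toVertex = x) :
    ∃ M : Lattice F, M.toVertex = y ∧ π ^ w.length • L.1 ≤ M.1 ∧ M.1 ≤ L.1 := by
  induction w with
  | nil => exact ⟨L, hx, by simp, le_rfl⟩
  | cons h w ih =>
    obtain ⟨M, hM, h1, h2⟩ := ih hx
    obtain ⟨N, hN, h3, h4⟩ := hπ.exists_lattice_of_adj (L := M) (by rw [hM]; exact h.symm)
    refine ⟨N, hN, ?_, h4.le.trans h2⟩
    rw [SimpleGraph.Walk.length_cons, pow_succ', mul_smul]
    exact (unit_smul_mono π h1).trans h3.le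

/-- M' = M + πᵈL lies one level closer to L, and πM' ⊆ M ⊆ M'. So M is either adjacent to M' or, in
the two cases of equality, represents the same vertex. -/
theorem reachable_of_le {L : Lattice F} (d : ℕ) (M : Lattice F) (h1 : π ^ d • L.1 ≤ M.1)
    (h2 : M.1 ≤ L.1) : (tree F).Reachable L.toVertex M.toVertex := by
  induction d generalizing M with
  | zero =>
    rw [pow_zero, one_smul] at h1
    rw [Lattice.ext (le_antisymm h1 h2)]
  | succ d ih =>
    have := M.2
    have := (scalarGL (π ^ d) • L).2
    let M' : Lattice F := ⟨M.1 ⊔ (scalarGL (π ^ d) • L).1, inferInstance⟩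
    have hsc : (scalarGL (π ^ d) • L).1 = π ^ d • L.1 := by
      rw [coe_smul, scalarGL_smul_submodule]
    have hdL : π ^ d • L.1 ≤ L.1 := by
      have := unit_smul_le_unit_smul (c := π ^ d) (d := 1)
        (by
          rw [Units.val_pow_eq_pow_val, map_pow, Units.val_one, map_one]
          exact pow_le_one₀ zero_le hπ.valuation_lt_one.le) L.1
      rwa [one_smul] at this
    have hM' : M'.1 = M.1 ⊔ π ^ d • L.1 := congrArg (M.1 ⊔ ·) hsc
    have hr := ih M' (hM' ▸ le_sup_right) (hM' ▸ sup_le h2 hdL)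
    have hle : M.1 ≤ M'.1 := le_sup_left
    have hle' : π • M'.1 ≤ M.1 := by
      rw [hM']
      refine (Submodule.map_sup _ _ _).le.trans (sup_le (hπ.smul_le_self _) ?_)
      rw [pow_succ', mul_smul] at h1
      exact h1
    rcases eq_or_lt_of_le hle with he | hlt
    · rwa [Lattice.ext he]
    rcases eq_or_lt_of_le hle' with he | hlt'
    · rwa [toVertex_eq_iff.2 ⟨π, he.symm⟩] at hr
    · exact hr.trans (hπ.adj_of_lt hlt' hlt).reachable

end IsUniformizer

variable [TopologicalSpace F] [IsNonarchimedeanLocalField F]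

theorem exists_isUniformizer : ∃ π : Fˣ, IsUniformizer π := by
  obtain ⟨π, h1, h0, hπ⟩ := exists_unif (F := F)
  exact ⟨Units.mk0 π ((Valuation.ne_zero_iff _).1 h0),
    fun x => ⟨hπ x, fun h => lt_of_le_of_lt h h1⟩⟩

theorem exists_frame_vertex (x : Vertex F) : ∃ g : GL (Fin 2) F, g • stdVertex F = x := by
  induction x using Quotient.inductionOn with
  | h L =>
    obtain ⟨g, hg⟩ := exists_frame L
    exact ⟨g, congrArg Lattice.toVertex (Lattice.ext hg.symm)⟩

theorem IsUniformizer.exists_pow_smul_le {π : Fˣ} (hπ : IsUniformizer π) (g : GL (Fin 2) F) :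
    ∃ n : ℕ, π ^ n • g • (stdSub : Submodule 𝒪[F] (Fin 2 → F)) ≤ stdSub := by
  have hma : MulArchimedean (ValuativeRel.ValueGroupWithZero F) :=
    ValuativeRel.isRankLeOne_iff_mulArchimedean.1 inferInstance
  obtain ⟨b, hb⟩ := Finset.exists_le (Finset.univ.image fun ij : Fin 2 × Fin 2 =>
    valuation F ((g : Matrix (Fin 2) (Fin 2) F) ij.1 ij.2))
  have hb' : max b 1 ≠ 0 := (lt_of_lt_of_le zero_lt_one (le_max_right b 1)).ne'
  -- The maximum with 1 makes the bound for the entries of `g` invertible.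
  obtain ⟨n, hn⟩ := exists_pow_lt₀ hπ.valuation_lt_one (Units.mk0 (max b 1) hb')⁻¹
  refine ⟨n, ?_⟩
  rw [← scalarGL_smul_submodule, smul_smul, smul_stdSub_le_iff]
  intro i j
  have h1 : ((scalarGL (π ^ n) * g : GL (Fin 2) F) : Matrix (Fin 2) (Fin 2) F) i j =
      (π : F) ^ n * (g : Matrix (Fin 2) (Fin 2) F) i j := by
    rw [scalarGL_mul_apply, Units.val_pow_eq_pow_val]
  rw [h1, map_mul, map_pow]
  have h2 : valuation F ((g : Matrix (Fin 2) (Fin 2) F) i j) ≤ max b 1 :=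
    (hb _ (Finset.mem_image_of_mem _ (Finset.mem_univ (i, j)))).trans (le_max_left _ _)
  refine (mul_le_mul' hn.le h2).trans (le_of_eq ?_)
  rw [Units.val_inv_eq_inv_val, Units.val_mk0, inv_mul_cancel₀ hb']

/-- After scaling, any lattice lies between πᵐ𝒪² and 𝒪², and `reachable_of_le` applies. The lower
inclusion comes from bounding the inverse matrix. -/
theorem tree_preconnected : (tree F).Preconnected := by
  obtain ⟨π, hπ⟩ := exists_isUniformizer (F := F)
  suffices h : ∀ g : GL (Fin 2) F, (tree F).Reachable (stdVertex F) (g • stdVertex F) by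
    intro x y
    obtain ⟨g, rfl⟩ := exists_frame_vertex x
    obtain ⟨h', rfl⟩ := exists_frame_vertex y
    exact (h g).symm.trans (h h')
  intro g
  obtain ⟨n, hn⟩ := hπ.exists_pow_smul_le g
  obtain ⟨m, hm⟩ := hπ.exists_pow_smul_le (scalarGL (π ^ n) * g)⁻¹
  have := hπ.reachable_of_le (L := stdLattice F) m ((scalarGL (π ^ n) * g) • stdLattice F) ?_ ?_
  · rwa [← smul_toVertex, mul_smul, scalarGL_smul_vertex] at this
  · have h := gl_smul_mono (scalarGL (π ^ n) * g) hm
    rwa [smul_scalar_comm, smul_inv_smul] at h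
  · rw [coe_smul, mul_smul, scalarGL_smul_submodule]
    exact hn

theorem IsUniformizer.exists_lattice_of_dist_le {π : Fˣ} (hπ : IsUniformizer π) {L : Lattice F}
    {y : Vertex F} {d : ℕ} (h : (tree F).dist L.toVertex y ≤ d) :
    ∃ M : Lattice F, M.toVertex = y ∧ π ^ d • L.1 ≤ M.1 ∧ M.1 ≤ L.1 := by
  -- `dist` takes the value 0 between unreachable vertices, so connectedness is needed to turn the
  -- distance bound into a walk.
  obtain ⟨w, hw⟩ := (tree_preconnected y L.toVertex).exists_walk_length_eq_dist
  rw [SimpleGraph.dist_comm, ← hw] at h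
  obtain ⟨M, hM, h1, h2⟩ := hπ.exists_lattice_of_walk w rfl
  refine ⟨M, hM, (unit_smul_le_unit_smul ?_ _).trans h1, h2⟩
  rw [Units.val_pow_eq_pow_val, Units.val_pow_eq_pow_val, map_pow, map_pow]
  exact pow_le_pow_of_le_one zero_le hπ.valuation_lt_one.le h

end Neighbours
end BTTree

/-! ### Neighbours of the standard vertex, and transitivity on oriented edges -/

namespace BTTree

section Stabilizers

open ValuativeRel (valuation)
open Matrix

variable {F : Type*} [Field F] [ValuativeRel F]

theorem mem_lowerGL_mul_diagGL_smul {c : F} {t : Fˣ} {w : Fin 2 → F} :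
    w ∈ (lowerGL c * diagGL t) • (stdSub : Submodule 𝒪[F] (Fin 2 → F)) ↔
      valuation F (w 0) ≤ 1 ∧ valuation F (w 1 - c * w 0) ≤ valuation F (t : F) := by
  rw [mem_gl_smul, _root_.mul_inv_rev, lowerGL_inv, diagGL_inv, mem_stdSub, Fin.forall_fin_two]
  have h0 : ((diagGL t⁻¹ * lowerGL (-c)) • w) 0 = w 0 := by
    rw [toMatrix_smul]
    simp [diagGL, lowerGL, Matrix.mulVec, dotProduct, Fin.sum_univ_two]
  have h1 : ((diagGL t⁻¹ * lowerGL (-c)) • w) 1 = ((t⁻¹ : Fˣ) : F) * (w 1 - c * w 0) := by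
    rw [toMatrix_smul]
    simp [diagGL, lowerGL, Matrix.mulVec, dotProduct, Fin.sum_univ_two]
    ring
  rw [h0, h1, map_mul, valuation_unit_inv,
    inv_mul_le_iff₀ (zero_lt_iff.2 (valuation_unit_ne_zero t)), mul_one]

namespace IsUniformizer

variable {π : Fˣ} (hπ : IsUniformizer π)

include hπ

theorem valuation_pow_le_one (n : ℕ) : valuation F ((π ^ n : Fˣ) : F) ≤ 1 := by
  rw [Units.val_pow_eq_pow_val, map_pow]
  exact pow_le_one₀ zero_le hπ.valuation_lt_one.le

theorem adj_stdVertex : (tree F).Adj (stdVertex F) (diagGL π • stdVertex F) := by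
  have hm : ∀ w : Fin 2 → F, w ∈ diagGL π • (stdSub : Submodule 𝒪[F] (Fin 2 → F)) ↔
      valuation F (w 0) ≤ 1 ∧ valuation F (w 1) ≤ valuation F (π : F) := fun w => by
    simpa [lowerGL_zero] using mem_lowerGL_mul_diagGL_smul (c := (0 : F)) (t := π) (w := w)
  refine hπ.adj_of_lt (L := stdLattice F) (M := diagGL π • stdLattice F) ?_ ?_
  · refine lt_of_le_of_ne (fun w hw => (hm w).2 ?_) fun he => ?_
    · obtain ⟨u, hu, rfl⟩ := hw
      have h1 : ∀ i, valuation F ((π • u) i) ≤ valuation F (π : F) := fun i => by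
        change valuation F ((π : F) * u i) ≤ _
        rw [map_mul]
        exact mul_le_of_le_one_right' (hu i)
      exact ⟨(h1 0).trans hπ.valuation_lt_one.le, h1 1⟩
    · have h1 : (Pi.single 0 1 : Fin 2 → F) ∈ π • (stdLattice F).1 := by
        rw [he]
        exact (hm _).2 (by simp)
      have h2 := mem_unit_smul.1 h1 0
      have h3 : (π⁻¹ • (Pi.single 0 1 : Fin 2 → F)) 0 = ((π⁻¹ : Fˣ) : F) := by
        simp [Units.smul_def]
      rw [h3, valuation_unit_inv, inv_le_one₀ (zero_lt_iff.2 (valuation_unit_ne_zero π))] at h2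
      exact absurd h2 (not_le.2 hπ.valuation_lt_one)
  · refine lt_of_le_of_ne (fun w hw => ?_) fun he => ?_
    · obtain ⟨h1, h2⟩ := (hm w).1 hw
      exact Fin.forall_fin_two.2 ⟨h1, h2.trans hπ.valuation_lt_one.le⟩
    · have h1 : (Pi.single 1 1 : Fin 2 → F) ∈ (diagGL π • stdLattice F).1 := by
        rw [he]
        exact single_mem_stdSub 1
      have h2 := ((hm _).1 h1).2
      simp only [Pi.single_eq_same, map_one] at h2
      exact absurd h2 (not_le.2 hπ.valuation_lt_one)

/-- Neighbours are the lines in the residue plane. A line not contained in the second coordinate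
axis is spanned by (1, c). The remaining line is that axis, with lattice π𝒪 ⊕ 𝒪. On the ray 𝒪 ⊕ πᵏ𝒪
the first kind points forward, and the last one is the vertex before 𝒪². -/
theorem eq_of_adj_stdVertex {z : Vertex F} (h : (tree F).Adj (stdVertex F) z) :
    (∃ c : F, valuation F c ≤ 1 ∧ z = lowerGL c • diagGL π • stdVertex F) ∨
      z = diagGL π⁻¹ • stdVertex F := by
  obtain ⟨M, rfl, h1, h2⟩ := hπ.exists_lattice_of_adj (L := stdLattice F) h
  change π • stdSub < M.1 at h1
  change M.1 < stdSub at h2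
  have hπmem : ∀ w : Fin 2 → F, (∀ i, valuation F (w i) ≤ valuation F (π : F)) → w ∈ M.1 := by
    intro w hw
    refine h1.le (mem_unit_smul.2 fun i => ?_)
    change valuation F (((π⁻¹ : Fˣ) : F) * w i) ≤ 1
    rw [map_mul, valuation_unit_inv, inv_mul_le_iff₀ (zero_lt_iff.2 (valuation_unit_ne_zero π)),
      mul_one]
    exact hw i
  -- Since M is a proper sublattice of 𝒪², it cannot contain both basis vectors.
  have hfull : (Pi.single 0 1 : Fin 2 → F) ∈ M.1 → (Pi.single 1 1 : Fin 2 → F) ∈ M.1 → False := by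
    intro e0 e1
    refine absurd h2 (not_lt_of_ge fun w hw => ?_)
    have h : w = w 0 • (Pi.single 0 1 : Fin 2 → F) + w 1 • (Pi.single 1 1 : Fin 2 → F) := by
      funext i
      fin_cases i <;> simp
    rw [h]
    exact add_mem (smul_mem_of_valuation_le e0 (hw 0)) (smul_mem_of_valuation_le e1 (hw 1))
  -- This decides whether the line M/π𝒪² has a vector with nonzero first coordinate.
  by_cases hex : ∃ w ∈ M.1, valuation F (w 0) = 1
  · left
    obtain ⟨w, hw, hw0⟩ := hex
    have hne : w 0 ≠ 0 := fun h0 => by simp [h0] at hw0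
    set c := w 1 * (w 0)⁻¹ with hc
    have hc1 : valuation F c ≤ 1 := by
      rw [hc, map_mul, map_inv₀, hw0, inv_one, mul_one]
      exact h2.le hw 1
    have hcM : ![1, c] ∈ M.1 := by
      have : ![1, c] = (w 0)⁻¹ • w := by
        funext i
        fin_cases i
        · simp [hne]
        · simp [hc, mul_comm]
      rw [this]
      exact smul_mem_of_valuation_le hw (by rw [map_inv₀, hw0, inv_one])
    refine ⟨c, hc1, ?_⟩
    rw [smul_smul]
    refine congrArg Lattice.toVertex (Lattice.ext ?_)
    rw [coe_smul]
    refine le_antisymm (fun u hu => ?_) fun u hu => ?_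
    · refine mem_lowerGL_mul_diagGL_smul.2 ⟨h2.le hu 0, (hπ _).1 ?_⟩
      have h3 : u - u 0 • ![1, c] ∈ M.1 :=
        sub_mem hu (smul_mem_of_valuation_le hcM (h2.le hu 0))
      have h4 : u - u 0 • ![1, c] = (u 1 - c * u 0) • (Pi.single 1 1 : Fin 2 → F) := by
        funext i
        fin_cases i <;> simp [mul_comm]
      rw [h4] at h3
      have h5 : valuation F (u 1 - c * u 0) ≤ 1 := by
        simpa using h2.le h3 1
      refine lt_of_le_of_ne h5 fun h6 => ?_
      have e1 : (Pi.single 1 1 : Fin 2 → F) ∈ M.1 := by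
        have := smul_mem_of_valuation_le h3 (a := (u 1 - c * u 0)⁻¹)
          (by rw [map_inv₀, h6, inv_one])
        rwa [smul_smul, inv_mul_cancel₀, one_smul] at this
        intro h0
        simp [h0] at h6
      refine hfull ?_ e1
      have := sub_mem hcM (smul_mem_of_valuation_le e1 hc1)
      convert this using 1
      funext i
      fin_cases i <;> simp
    · obtain ⟨h3, h4⟩ := mem_lowerGL_mul_diagGL_smul.1 hu
      have h5 : u = u 0 • ![1, c] + (u - u 0 • ![1, c]) := by abel
      rw [h5]
      refine add_mem (smul_mem_of_valuation_le hcM h3) (hπmem _ (Fin.forall_fin_two.2 ⟨?_, ?_⟩))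
      · simp
      · simpa [mul_comm] using h4
  · right
    push Not at hex
    have hlt : ∀ u ∈ M.1, valuation F (u 0) ≤ valuation F (π : F) := fun u hu =>
      (hπ _).1 (lt_of_le_of_ne (h2.le hu 0) (hex u hu))
    -- M is strictly larger than π𝒪² while its first coordinates lie in π𝒪, so some second
    -- coordinate is a unit.
    have e1 : (Pi.single 1 1 : Fin 2 → F) ∈ M.1 := by
      obtain ⟨w, hw, hw'⟩ := Set.exists_of_ssubset h1
      have hw1 : valuation F (w 1) = 1 := by
        refine le_antisymm (h2.le hw 1) (not_lt.1 fun h3 => hw' ?_)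
        refine mem_unit_smul.2 (Fin.forall_fin_two.2 ⟨?_, ?_⟩)
        · change valuation F (((π⁻¹ : Fˣ) : F) * w 0) ≤ 1
          rw [map_mul, valuation_unit_inv,
            inv_mul_le_iff₀ (zero_lt_iff.2 (valuation_unit_ne_zero π)), mul_one]
          exact hlt w hw
        · change valuation F (((π⁻¹ : Fˣ) : F) * w 1) ≤ 1
          rw [map_mul, valuation_unit_inv,
            inv_mul_le_iff₀ (zero_lt_iff.2 (valuation_unit_ne_zero π)), mul_one]
          exact (hπ _).1 h3
      have hne : w 1 ≠ 0 := fun h0 => by simp [h0] at hw1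
      have h3 : w - w 0 • (Pi.single 0 1 : Fin 2 → F) ∈ M.1 :=
        sub_mem hw (hπmem _ (Fin.forall_fin_two.2 ⟨by simpa using hlt w hw, by simp⟩))
      have h4 := smul_mem_of_valuation_le h3 (a := (w 1)⁻¹) (by rw [map_inv₀, hw1, inv_one])
      convert h4 using 1
      funext i
      fin_cases i <;> simp [hne]
    -- The homothety factor is π, because π𝒪 ⊕ 𝒪 = π(𝒪 ⊕ π⁻¹𝒪).
    refine (toVertex_eq_iff.2 ⟨π, ?_⟩).symm
    ext u
    rw [coe_smul, mem_unit_smul, ← one_mul (diagGL π⁻¹), ← lowerGL_zero]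
    refine Iff.trans ?_ mem_lowerGL_mul_diagGL_smul.symm
    have e : ∀ i, (π⁻¹ • u) i = ((π⁻¹ : Fˣ) : F) * u i := fun i => rfl
    rw [e, e, zero_mul, sub_zero, map_mul, map_mul, valuation_unit_inv,
      inv_mul_le_iff₀ (zero_lt_iff.2 (valuation_unit_ne_zero π)), mul_one,
      mul_le_iff_le_one_right (zero_lt_iff.2 (inv_ne_zero (valuation_unit_ne_zero π)))]
    refine ⟨fun hu => ⟨hlt u hu, h2.le hu 1⟩, fun ⟨h3, h4⟩ => ?_⟩
    have h5 : u = u 0 • (Pi.single 0 1 : Fin 2 → F) + u 1 • (Pi.single 1 1 : Fin 2 → F) := by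
      funext i
      fin_cases i <;> simp
    rw [h5]
    exact add_mem (hπmem _ (Fin.forall_fin_two.2 ⟨by simpa using h3, by simp⟩))
      (smul_mem_of_valuation_le e1 h4)

end IsUniformizer

variable [TopologicalSpace F] [IsNonarchimedeanLocalField F]

theorem mem_K_stdVertex {g : GL (Fin 2) F} : g ∈ K (stdVertex F) ↔
    g • (stdSub : Submodule 𝒪[F] (Fin 2 → F)) = stdSub :=
  mem_K_of_lattice

theorem mem_K_stdVertex_of_entries {g : GL (Fin 2) F}
    (h : ∀ i j, valuation F ((g : Matrix (Fin 2) (Fin 2) F) i j) ≤ 1)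
    (h' : ∀ i j, valuation F (((g⁻¹ : GL (Fin 2) F) : Matrix (Fin 2) (Fin 2) F) i j) ≤ 1) :
    g ∈ K (stdVertex F) :=
  mem_K_stdVertex.2 (smul_stdSub_eq_iff.2 ⟨h, h'⟩)

theorem lowerGL_mem_K {c : F} (hc : valuation F c ≤ 1) : lowerGL c ∈ K (stdVertex F) := by
  refine mem_K_stdVertex_of_entries ?_ ?_
  · simp [Fin.forall_fin_two, lowerGL, hc]
  · rw [lowerGL_inv]
    simp [Fin.forall_fin_two, lowerGL, hc]

theorem swapGL_mem_K : swapGL F ∈ K (stdVertex F) := by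
  refine mem_K_stdVertex_of_entries ?_ ?_
  · simp [Fin.forall_fin_two, swapGL]
  · rw [swapGL_inv]
    simp [Fin.forall_fin_two, swapGL]

/-- Conjugating by `diagGL t` divides the entry by t, which leaves it integral. -/
theorem lowerGL_smul_diagGL_vertex {c : F} {t : Fˣ} (h : valuation F c ≤ valuation F (t : F)) :
    lowerGL c • diagGL t • stdVertex F = diagGL t • stdVertex F := by
  have h1 : lowerGL c * diagGL t = diagGL t * lowerGL (((t⁻¹ : Fˣ) : F) * c) := by
    have := diagGL_conj_lowerGL t (((t⁻¹ : Fˣ) : F) * c)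
    rw [Units.mul_inv_cancel_left] at this
    rw [← this, inv_mul_cancel_right]
  rw [smul_smul, h1, mul_smul, smul_eq_of_mem_K (lowerGL_mem_K _)]
  rw [map_mul, valuation_unit_inv, inv_mul_le_iff₀ (zero_lt_iff.2 (valuation_unit_ne_zero t)),
    mul_one]
  exact h

/-- `G` acts transitively on the oriented edges. -/
theorem IsUniformizer.exists_frame_edge {π : Fˣ} (hπ : IsUniformizer π) {x y : Vertex F} (h : (tree F).Adj x y) :
    ∃ g : GL (Fin 2) F, g • stdVertex F = x ∧ g • diagGL π • stdVertex F = y := by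
  obtain ⟨g, rfl⟩ := exists_frame_vertex x
  have h1 : (tree F).Adj (stdVertex F) (g⁻¹ • y) := by
    rw [← tree_adj_smul_iff (g := g), smul_inv_smul]
    exact h
  -- Either kind of neighbour is carried to the standard one by an element of `K (stdVertex F)`: an
  -- integral lower unipotent or the transposition.
  rcases hπ.eq_of_adj_stdVertex h1 with ⟨c, hc, h2⟩ | h2
  · refine ⟨g * lowerGL c, ?_, ?_⟩
    · rw [mul_smul, smul_eq_of_mem_K (lowerGL_mem_K hc)]
    · rw [mul_smul, ← h2, smul_inv_smul]
  · refine ⟨g * swapGL F, ?_, ?_⟩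
    · rw [mul_smul, smul_eq_of_mem_K swapGL_mem_K]
    · rw [mul_smul, ← smul_inv_smul g y, h2]
      congr 1
      conv_lhs => rw [← smul_eq_of_mem_K swapGL_mem_K]
      rw [smul_smul, smul_smul, swapGL_conj_diagGL, mul_smul, scalarGL_smul_vertex]

end Stabilizers
end BTTree

/-! ### Congruence subgroups and pointwise stabilizers of balls -/

namespace BTTree

section Congruence

set_option linter.unusedSectionVars false

open ValuativeRel (valuation)
open Matrix

variable {F : Type*} [Field F] [ValuativeRel F] [TopologicalSpace F]
  [IsNonarchimedeanLocalField F]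

theorem valuation_eq_one_of_sub_one_lt {x : F} (h : valuation F (x - 1) < 1) :
    valuation F x = 1 := by
  simpa using Valuation.map_one_add_of_lt (v := valuation F) h

/-- The determinant is a unit, so g⁻¹ is integral, and g⁻¹ - 1 = -g⁻¹(g - 1). -/
theorem mem_smallGL_of_sub_one_mem {c : ValuativeRel.ValueGroupWithZero F} (hc : c < 1)
    {g : GL (Fin 2) F} (hg : (g : Matrix (Fin 2) (Fin 2) F) - 1 ∈ smallMat c) :
    g ∈ smallGL c := by
  refine ⟨hg, ?_⟩
  set A : Matrix (Fin 2) (Fin 2) F := (g : Matrix (Fin 2) (Fin 2) F) with hA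
  have h00 : valuation F (A 0 0 - 1) ≤ c := hg 0 0
  have h11 : valuation F (A 1 1 - 1) ≤ c := hg 1 1
  have h01 : valuation F (A 0 1) ≤ c := by simpa using hg 0 1
  have h10 : valuation F (A 1 0) ≤ c := by simpa using hg 1 0
  have hd : valuation F (A.det - 1) < 1 := by
    have h1 : A.det - 1 = (A 0 0 - 1) * A 1 1 + (A 1 1 - 1) - A 0 1 * A 1 0 := by
      rw [Matrix.det_fin_two]
      ring
    rw [h1]
    refine (Valuation.map_sub _ _ _).trans_lt (max_lt ((Valuation.map_add _ _ _).trans_lt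
      (max_lt ?_ (h11.trans_lt hc))) ?_)
    · rw [map_mul, valuation_eq_one_of_sub_one_lt (h11.trans_lt hc), mul_one]
      exact h00.trans_lt hc
    · rw [map_mul]
      exact mul_lt_one_of_lt_of_le (h01.trans_lt hc) (h10.trans hc.le)
  have hdet := valuation_eq_one_of_sub_one_lt hd
  have hinv : ((g⁻¹ : GL (Fin 2) F) : Matrix (Fin 2) (Fin 2) F) ∈ smallMat 1 := by
    have hadj : A.adjugate ∈ smallMat 1 := by
      rw [Matrix.adjugate_fin_two]
      refine Fin.forall_fin_two.2 ⟨Fin.forall_fin_two.2 ⟨?_, ?_⟩, Fin.forall_fin_two.2 ⟨?_, ?_⟩⟩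
      · exact (valuation_eq_one_of_sub_one_lt (h11.trans_lt hc)).le
      · simpa using h01.trans hc.le
      · simpa using h10.trans hc.le
      · exact (valuation_eq_one_of_sub_one_lt (h00.trans_lt hc)).le
    intro i j
    rw [Matrix.coe_units_inv, Matrix.inv_def, Matrix.smul_apply, smul_eq_mul, ← hA,
      Ring.inverse_eq_inv', map_mul, map_inv₀, hdet, inv_one, one_mul]
    exact hadj i j
  intro i j
  have h4 := smallMat_mul hinv hg i j
  rw [mul_sub, mul_one, hA, Units.inv_mul, one_mul, ← neg_sub, Matrix.neg_apply,
    Valuation.map_neg] at h4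
  exact h4

theorem inv_mem_smallGL {c : ValuativeRel.ValueGroupWithZero F} {g : GL (Fin 2) F}
    (hg : g ∈ smallGL c) : g⁻¹ ∈ smallGL c := ⟨hg.2, by rw [inv_inv]; exact hg.1⟩

theorem smul_sub_mem_of_smallGL {c : Fˣ} {g : GL (Fin 2) F}
    (hg : g ∈ smallGL (valuation F (c : F))) {w : Fin 2 → F}
    (hw : w ∈ (stdSub : Submodule 𝒪[F] (Fin 2 → F))) :
    g • w - w ∈ c • (stdSub : Submodule 𝒪[F] (Fin 2 → F)) := by
  refine mem_unit_smul.2 fun i => ?_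
  have h1 : g • w - w = ((g : Matrix (Fin 2) (Fin 2) F) - 1) *ᵥ w := by
    rw [Matrix.sub_mulVec, Matrix.one_mulVec, toMatrix_smul]
  change valuation F (((c⁻¹ : Fˣ) : F) * (g • w - w) i) ≤ 1
  rw [map_mul, valuation_unit_inv, inv_mul_le_iff₀ (zero_lt_iff.2 (valuation_unit_ne_zero c)),
    mul_one, h1, Matrix.mulVec, dotProduct]
  refine Valuation.map_sum_le _ fun j _ => ?_
  rw [map_mul]
  exact (mul_le_mul' (hg.1 i j) (hw j)).trans (mul_one _).le

/-- Elements congruent to `1` modulo `c` stabilize all lattices between `c 𝒪²` and `𝒪²`. -/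
theorem smul_eq_of_smallGL {c : Fˣ} {g : GL (Fin 2) F} (hg : g ∈ smallGL (valuation F (c : F)))
    {M : Submodule 𝒪[F] (Fin 2 → F)} (h1 : c • stdSub ≤ M) (h2 : M ≤ stdSub) : g • M = M := by
  have key : ∀ k ∈ smallGL (valuation F (c : F)), ∀ w ∈ M, k • w ∈ M := fun k hk w hw => by
    have := add_mem (h1 (smul_sub_mem_of_smallGL hk (h2 hw))) hw
    rwa [sub_add_cancel] at this
  exact gl_smul_eq_of_forall_mem (key g hg) (key _ (inv_mem_smallGL hg))

theorem smul_eq_of_smallGL_of_mem_ballV {π : Fˣ} (hπ : IsUniformizer π) {e : ℕ} {g : GL (Fin 2) F}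
    (hg : g ∈ smallGL (valuation F ((π ^ e : Fˣ) : F))) {y : Vertex F}
    (hy : y ∈ ballV e (stdVertex F)) : g • y = y := by
  obtain ⟨M, rfl, h1, h2⟩ := hπ.exists_lattice_of_dist_le (L := stdLattice F) hy
  exact congrArg Lattice.toVertex (Lattice.ext (smul_eq_of_smallGL hg h1 h2))

/-- A vertex at distance at most e - 1 has a lattice M with πᵉ⁻¹𝒪² ⊆ M ⊆ 𝒪². Then g - 1 maps M into
πᵉ𝒪² ⊆ πM. -/
theorem mem_UV_of_smallGL {π : Fˣ} (hπ : IsUniformizer π) {e : ℕ} {g : GL (Fin 2) F}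
    (hg : g ∈ smallGL (valuation F ((π ^ e : Fˣ) : F))) : g ∈ UV e (stdVertex F) := by
  refine Subgroup.mem_iInf.2 fun y => Subgroup.mem_iInf.2 fun hy => ?_
  -- `hy` forces `e` to be positive, so the subtraction is not truncated.
  obtain ⟨d, rfl⟩ : ∃ d, e = d + 1 := ⟨e - 1, by omega⟩
  obtain ⟨M, rfl, h1, h2⟩ := hπ.exists_lattice_of_dist_le (L := stdLattice F)
    (show (tree F).dist (stdVertex F) y ≤ d by omega)
  have h3 : π ^ (d + 1) • (stdSub : Submodule 𝒪[F] (Fin 2 → F)) ≤ π • M.1 := by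
    rw [pow_succ', mul_smul]
    exact unit_smul_mono π h1
  refine mem_U1_of_lattice.2
    ⟨smul_eq_of_smallGL hg (h3.trans (hπ.smul_le_self _)) h2, fun w hw => ?_⟩
  rw [hπ.maximalIdeal_smul]
  exact h3 (smul_sub_mem_of_smallGL hg (h2 hw))

theorem conj_mem_U1_smul {x : Vertex F} (g : GL (Fin 2) F) {u : GL (Fin 2) F} (hu : u ∈ U1 x) :
    g * u * g⁻¹ ∈ U1 (g • x) := by
  induction x using Quotient.inductionOn with
  | h L =>
  change u ∈ U1 L.toVertex at hu
  change g * u * g⁻¹ ∈ U1 (g • L).toVertex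
  rw [mem_U1_of_lattice] at hu ⊢
  obtain ⟨h1, h2⟩ := hu
  refine ⟨by rw [coe_smul, mul_smul, mul_smul, inv_smul_smul, h1], fun w hw => ?_⟩
  have h3 := h2 _ (mem_gl_smul.1 hw)
  rw [coe_smul, ← smul_maximalIdeal_smul, mem_gl_smul, smul_sub, ← mul_smul]
  rw [← mul_smul] at h3
  convert h3 using 3
  group

theorem conj_mem_UV_smul {e : ℕ} {x : Vertex F} (g : GL (Fin 2) F) {u : GL (Fin 2) F}
    (hu : u ∈ UV e x) : g * u * g⁻¹ ∈ UV e (g • x) := by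
  refine Subgroup.mem_iInf.2 fun y => Subgroup.mem_iInf.2 fun hy => ?_
  have h1 := Subgroup.mem_iInf.1 (Subgroup.mem_iInf.1 hu (g⁻¹ • y))
    (by rwa [← dist_smul g, smul_inv_smul])
  simpa using conj_mem_U1_smul g h1

theorem valuation_det_of_mem_K {k : GL (Fin 2) F} (hk : k ∈ K (stdVertex F)) :
    valuation F (k : Matrix (Fin 2) (Fin 2) F).det = 1 := by
  have hle : ∀ g ∈ K (stdVertex F), valuation F (g : Matrix (Fin 2) (Fin 2) F).det ≤ 1 := by
    intro g hg
    have := val_det_le (h := g) (c := 1) (by rw [one_smul]; exact mem_K_stdVertex.1 hg)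
    simpa using this
  refine le_antisymm (hle k hk) ?_
  have h1 : valuation F (k : Matrix (Fin 2) (Fin 2) F).det *
      valuation F ((k⁻¹ : GL (Fin 2) F) : Matrix (Fin 2) (Fin 2) F).det = 1 := by
    rw [← map_mul, ← Matrix.det_mul, Units.mul_inv, Matrix.det_one, map_one]
  rw [← h1]
  exact mul_le_of_le_one_right' (hle _ (inv_mem hk))

/-- An element of `GL₂(𝒪)` fixing the vertex of `𝒪 ⊕ t 𝒪` is lower left divisible by `t`. -/
theorem valuation_entry_le_of_fixes {k : GL (Fin 2) F} (hk : k ∈ K (stdVertex F)) {t : Fˣ}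
    (h : k • diagGL t • stdVertex F = diagGL t • stdVertex F) :
    valuation F ((k : Matrix (Fin 2) (Fin 2) F) 1 0) ≤ valuation F (t : F) := by
  set k' := (diagGL t)⁻¹ * k * diagGL t with hk'
  have h1 : k' • stdVertex F = stdVertex F := by
    rw [hk', mul_smul, mul_smul, h, inv_smul_smul]
  obtain ⟨c, hc⟩ := stdVertex_eq_of_lattice.1 h1
  have hci : k'⁻¹ • (stdSub : Submodule 𝒪[F] (Fin 2 → F)) = c⁻¹ • stdSub := by
    rw [inv_smul_eq_iff, smul_scalar_comm, hc, inv_smul_smul]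
  have hdet : ((k'⁻¹ : GL (Fin 2) F) : Matrix (Fin 2) (Fin 2) F).det =
      ((k⁻¹ : GL (Fin 2) F) : Matrix (Fin 2) (Fin 2) F).det := by
    have : k'⁻¹ = (diagGL t)⁻¹ * k⁻¹ * diagGL t := by rw [hk']; group
    rw [this, Units.val_mul, Units.val_mul, Matrix.det_mul, Matrix.det_mul, mul_right_comm,
      ← Matrix.det_mul, Units.inv_mul, Matrix.det_one, one_mul]
  have h2 := val_det_le hci
  rw [hdet, valuation_det_of_mem_K (inv_mem hk), valuation_unit_inv] at h2
  -- The conjugate k' maps 𝒪² to c𝒪² and has unit determinant. So c cannot have valuation above 1,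
  -- and k' is integral. Its lower left entry is that of k divided by t.
  have hc1 : valuation F (c : F) ≤ 1 := by
    by_contra hlt
    rw [not_le] at hlt
    exact absurd h2 (not_le.2 (pow_lt_one₀ zero_le (inv_lt_one_of_one_lt₀ hlt) two_ne_zero))
  have h3 : k' • (stdSub : Submodule 𝒪[F] (Fin 2 → F)) ≤ stdSub := by
    rw [hc]
    have := unit_smul_le_unit_smul (c := c) (d := 1) (by simpa using hc1) stdSub
    rwa [one_smul] at this
  have h4 := smul_stdSub_le_iff.1 h3 1 0
  have h5 : (k' : Matrix (Fin 2) (Fin 2) F) 1 0 =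
      ((t⁻¹ : Fˣ) : F) * (k : Matrix (Fin 2) (Fin 2) F) 1 0 := by
    rw [hk', diagGL_inv]
    simp [diagGL, Matrix.mul_apply, Matrix.vecMul, dotProduct, Fin.sum_univ_two]
  rwa [h5, map_mul, valuation_unit_inv,
    inv_mul_le_iff₀ (zero_lt_iff.2 (valuation_unit_ne_zero t)), mul_one] at h4

theorem IsUniformizer.dist_stdVertex_le {π : Fˣ} (hπ : IsUniformizer π) (n : ℕ) :
    (tree F).dist (stdVertex F) (diagGL (π ^ n) • stdVertex F) ≤ n := by
  induction n with
  | zero =>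
    rw [pow_zero, diagGL_one, one_smul, SimpleGraph.dist_self]
  | succ n ih =>
    refine ((SimpleGraph.Connected.mk tree_preconnected (nonempty := ⟨stdVertex F⟩)).dist_triangle
      (v := diagGL (π ^ n) • stdVertex F)).trans (Nat.add_le_add ih (le_of_eq ?_))
    rw [pow_succ, diagGL_mul, mul_smul, dist_smul]
    exact SimpleGraph.dist_eq_one_iff_adj.2 hπ.adj_stdVertex

/-- The elements of `G` fixing the ball of radius `e` about the vertex of `𝒪²` are, up to scalars,
congruent to `1` modulo `π ^ e`. -/
theorem IsUniformizer.exists_scalar_of_fixes_ballV {π : Fˣ} (hπ : IsUniformizer π) {e : ℕ}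
    (he : 1 ≤ e) {h : GL (Fin 2) F} (hfix : ∀ y ∈ ballV e (stdVertex F), h • y = y) :
    ∃ c : Fˣ, scalarGL c * h ∈ smallGL (valuation F ((π ^ e : Fˣ) : F)) := by
  obtain ⟨c, hc⟩ := stdVertex_eq_of_lattice.1 (hfix (stdVertex F) (by simp [ballV]))
  set k := scalarGL c⁻¹ * h with hk
  have hkK : k ∈ K (stdVertex F) := by
    rw [mem_K_stdVertex, hk, mul_smul, hc, scalarGL_smul_submodule, inv_smul_smul]
  have hkfix : ∀ y ∈ ballV e (stdVertex F), k • y = y := fun y hy => by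
    rw [hk, mul_smul, hfix y hy, scalarGL_smul_vertex]
  -- Since q preserves distances from the standard vertex, the translate by q of the vertex of 𝒪 ⊕
  -- πᵉ𝒪 also lies in the ball. Varying q turns the bound on one entry into bounds on all the
  -- others.
  have hconj : ∀ q ∈ K (stdVertex F),
      valuation F ((q⁻¹ * k * q : GL (Fin 2) F) 1 0) ≤ valuation F ((π ^ e : Fˣ) : F) := by
    intro q hq
    refine valuation_entry_le_of_fixes (mul_mem (mul_mem (inv_mem hq) hkK) hq) ?_
    rw [mul_smul, mul_smul, inv_smul_eq_iff]
    refine hkfix _ ?_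
    have h1 := dist_smul q (stdVertex F) (diagGL (π ^ e) • stdVertex F)
    rw [smul_eq_of_mem_K hq] at h1
    exact h1.trans_le (hπ.dist_stdVertex_le e)
  have hint := (smul_stdSub_eq_iff.1 (mem_K_stdVertex.1 hkK)).1
  set A : Matrix (Fin 2) (Fin 2) F := (k : Matrix (Fin 2) (Fin 2) F) with hA
  have h10 : valuation F (A 1 0) ≤ valuation F ((π ^ e : Fˣ) : F) := by
    simpa using hconj 1 (one_mem _)
  have h01 : valuation F (A 0 1) ≤ valuation F ((π ^ e : Fˣ) : F) := by
    have := hconj _ swapGL_mem_K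
    rw [swapGL_inv] at this
    convert this using 2
    simp [swapGL, hA, Matrix.mul_apply, Matrix.vecMul, dotProduct, Fin.sum_univ_two]
  have h11 : valuation F (A 1 1 - A 0 0) ≤ valuation F ((π ^ e : Fˣ) : F) := by
    -- Conjugation by this unipotent mixes the diagonal into the lower left corner, giving A₁₁ - A₀₀
    -- up to off-diagonal entries that are already small.
    have h1 := hconj _ (lowerGL_mem_K (c := 1) (by simp))
    have h2 : A 1 1 - A 0 0 =
        (((lowerGL 1)⁻¹ * k * lowerGL 1 : GL (Fin 2) F) : Matrix (Fin 2) (Fin 2) F) 1 0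
          + (A 0 1 - A 1 0) := by
      rw [lowerGL_inv]
      simp only [lowerGL, Units.val_mul, ← hA, Matrix.mul_apply, Fin.sum_univ_two]
      simp
      ring
    rw [h2]
    exact (Valuation.map_add _ _ _).trans
      (max_le h1 ((Valuation.map_sub _ _ _).trans (max_le h01 h10)))
  have hlt : valuation F ((π ^ e : Fˣ) : F) < 1 := by
    rw [Units.val_pow_eq_pow_val, map_pow]
    exact pow_lt_one₀ zero_le hπ.valuation_lt_one (by omega)
  -- The determinant is a unit and A₀₁ is not, which uses e ≥ 1. Dividing by A₀₀ is then harmless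
  -- and brings the diagonal close to 1.
  have h00 : valuation F (A 0 0) = 1 := by
    refine le_antisymm (hint 0 0) (not_lt.1 fun h1 => ?_)
    have hd := valuation_det_of_mem_K hkK
    rw [Matrix.det_fin_two] at hd
    refine absurd hd (ne_of_lt (lt_of_le_of_lt (Valuation.map_sub _ _ _) (max_lt ?_ ?_))) <;>
      rw [map_mul]
    · exact mul_lt_one_of_lt_of_le h1 (hint 1 1)
    · exact mul_lt_one_of_lt_of_le (lt_of_le_of_lt h01 hlt) (hint 1 0)
  have hne : A 0 0 ≠ 0 := fun h0 => by simp [h0] at h00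
  let a : Fˣ := Units.mk0 (A 0 0) hne
  have ha : valuation F ((a⁻¹ : Fˣ) : F) = 1 := by
    rw [valuation_unit_inv]
    change (valuation F (A 0 0))⁻¹ = 1
    rw [h00, inv_one]
  set m := scalarGL a⁻¹ * k with hm
  have hmA : ∀ i j, (m : Matrix (Fin 2) (Fin 2) F) i j = ((a⁻¹ : Fˣ) : F) * A i j := fun i j =>
    scalarGL_mul_apply a⁻¹ k i j
  have hainv : ((a⁻¹ : Fˣ) : F) * A 0 0 = 1 := a.inv_mul
  have hm1 : (m : Matrix (Fin 2) (Fin 2) F) - 1 ∈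
      smallMat (valuation F ((π ^ e : Fˣ) : F)) := by
    have e11 : ((a⁻¹ : Fˣ) : F) * A 1 1 - 1 = ((a⁻¹ : Fˣ) : F) * (A 1 1 - A 0 0) := by
      rw [mul_sub, hainv]
    refine Fin.forall_fin_two.2 ⟨Fin.forall_fin_two.2 ⟨?_, ?_⟩, Fin.forall_fin_two.2 ⟨?_, ?_⟩⟩ <;>
      rw [Matrix.sub_apply, hmA]
    · rw [hainv]; simp
    · rw [Matrix.one_apply_ne (by decide), sub_zero, map_mul, ha, one_mul]; exact h01
    · rw [Matrix.one_apply_ne (by decide), sub_zero, map_mul, ha, one_mul]; exact h10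
    · rw [Matrix.one_apply_eq, e11, map_mul, ha, one_mul]; exact h11
  refine ⟨a⁻¹ * c⁻¹, ?_⟩
  rw [scalarGL_mul, mul_assoc, ← hk, ← hm]
  exact mem_smallGL_of_sub_one_mem hlt hm1

end Congruence
end BTTree

/-! ### Propagation along rays -/

namespace BTTree

section Propagation

set_option linter.unusedSectionVars false

open ValuativeRel (valuation)
open Matrix

variable {F : Type*} [Field F] [ValuativeRel F] [TopologicalSpace F]
  [IsNonarchimedeanLocalField F]

theorem smul_mem_ballV_iff {e : ℕ} {g : GL (Fin 2) F} {x z : Vertex F} :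
    g • z ∈ ballV e (g • x) ↔ z ∈ ballV e x := by
  change (tree F).dist _ _ ≤ e ↔ (tree F).dist _ _ ≤ e
  rw [dist_smul]

theorem ballE_comm (e : ℕ) (x y : Vertex F) : ballE e x y = ballE e y x := Set.union_comm _ _

theorem UE_comm (e : ℕ) (x y : Vertex F) : UE e x y = UE e y x := sup_comm _ _

namespace IsUniformizer

variable {π : Fˣ} (hπ : IsUniformizer π)

include hπ

theorem valuation_pow_lt_one {e : ℕ} (he : 1 ≤ e) : valuation F ((π ^ e : Fˣ) : F) < 1 := by
  rw [Units.val_pow_eq_pow_val, map_pow]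
  exact pow_lt_one₀ zero_le hπ.valuation_lt_one (by omega)

theorem lowerGL_mem_smallGL {e : ℕ} (he : 1 ≤ e) {c : F}
    (hc : valuation F c ≤ valuation F ((π ^ e : Fˣ) : F)) :
    lowerGL c ∈ smallGL (valuation F ((π ^ e : Fˣ) : F)) := by
  refine mem_smallGL_of_sub_one_mem (hπ.valuation_pow_lt_one he) ?_
  refine Fin.forall_fin_two.2 ⟨Fin.forall_fin_two.2 ⟨?_, ?_⟩, Fin.forall_fin_two.2 ⟨?_, ?_⟩⟩ <;>
    simp [lowerGL]
  simpa using hc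

/-- A matrix congruent to `1` is the product of a lower unipotent matrix and an upper triangular
one, which fixes the balls about both ends of the standard edge. -/
theorem exists_eq_lowerGL_mul {e : ℕ} (he : 1 ≤ e) {m : GL (Fin 2) F}
    (hm : m ∈ smallGL (valuation F ((π ^ e : Fˣ) : F))) :
    ∃ (c : F) (b : GL (Fin 2) F), valuation F c ≤ valuation F ((π ^ e : Fˣ) : F) ∧
      m = lowerGL c * b ∧
      ∀ z ∈ ballE e (stdVertex F) (diagGL π • stdVertex F), b • z = z := by
  have hlt := hπ.valuation_pow_lt_one he
  set A : Matrix (Fin 2) (Fin 2) F := (m : Matrix (Fin 2) (Fin 2) F) with hA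
  have h00 : valuation F (A 0 0 - 1) ≤ valuation F ((π ^ e : Fˣ) : F) := hm.1 0 0
  have h11 : valuation F (A 1 1 - 1) ≤ valuation F ((π ^ e : Fˣ) : F) := hm.1 1 1
  have h01 : valuation F (A 0 1) ≤ valuation F ((π ^ e : Fˣ) : F) := by simpa [hA] using hm.1 0 1
  have h10 : valuation F (A 1 0) ≤ valuation F ((π ^ e : Fˣ) : F) := by simpa [hA] using hm.1 1 0
  have ha := valuation_eq_one_of_sub_one_lt (h00.trans_lt hlt)
  have hne : A 0 0 ≠ 0 := fun h0 => by simp [h0] at ha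
  set c := A 1 0 * (A 0 0)⁻¹ with hc
  have hcv : valuation F c ≤ valuation F ((π ^ e : Fˣ) : F) := by
    rw [hc, map_mul, map_inv₀, ha, inv_one, mul_one]
    exact h10
  have hcA : c * A 0 0 = A 1 0 := inv_mul_cancel_right₀ hne _
  set b := (lowerGL c)⁻¹ * m with hb
  have hbA : (b : Matrix (Fin 2) (Fin 2) F) = !![A 0 0, A 0 1; 0, A 1 1 - c * A 0 1] := by
    rw [hb, lowerGL_inv, Units.val_mul, ← hA, Matrix.eta_fin_two A]
    simp only [lowerGL, Matrix.mul_fin_two]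
    simp [hcA]
    ring
  have hd : valuation F (A 1 1 - c * A 0 1 - 1) ≤ valuation F ((π ^ e : Fˣ) : F) := by
    rw [sub_right_comm]
    refine (Valuation.map_sub _ _ _).trans (max_le h11 ?_)
    rw [map_mul]
    exact (mul_le_mul' (hcv.trans hlt.le) h01).trans (one_mul _).le
  have hb1 : b ∈ smallGL (valuation F ((π ^ e : Fˣ) : F)) := by
    refine mem_smallGL_of_sub_one_mem hlt ?_
    rw [hbA]
    refine Fin.forall_fin_two.2 ⟨Fin.forall_fin_two.2 ⟨?_, ?_⟩, Fin.forall_fin_two.2 ⟨?_, ?_⟩⟩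
    · simpa using h00
    · simpa using h01
    · simp
    · simpa using hd
  -- Moving the base point one step forward multiplies the upper right entry by π. So b stays
  -- congruent to 1 and fixes the ball about the other end too.
  have hb2 : (diagGL π)⁻¹ * b * diagGL π ∈ smallGL (valuation F ((π ^ e : Fˣ) : F)) := by
    have hB : (((diagGL π)⁻¹ * b * diagGL π : GL (Fin 2) F) : Matrix (Fin 2) (Fin 2) F) =
        !![A 0 0, A 0 1 * (π : F); 0, A 1 1 - c * A 0 1] := by
      rw [diagGL_inv, Units.val_mul, Units.val_mul, hbA]
      simp only [diagGL, Matrix.mul_fin_two]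
      simp [mul_comm]
    refine mem_smallGL_of_sub_one_mem hlt ?_
    rw [hB]
    refine Fin.forall_fin_two.2 ⟨Fin.forall_fin_two.2 ⟨?_, ?_⟩, Fin.forall_fin_two.2 ⟨?_, ?_⟩⟩
    · simpa using h00
    · have h2 : valuation F (A 0 1 * (π : F)) ≤ valuation F ((π ^ e : Fˣ) : F) := by
        rw [map_mul]
        exact (mul_le_mul' h01 hπ.valuation_lt_one.le).trans (mul_one _).le
      simpa using h2
    · simp
    · simpa using hd
  refine ⟨c, b, hcv, (mul_inv_cancel_left _ _).symm, fun z hz => ?_⟩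
  rcases hz with hz | hz
  · exact smul_eq_of_smallGL_of_mem_ballV hπ hb1 hz
  · rw [← smul_inv_smul (diagGL π) z, smul_mem_ballV_iff] at hz
    have h := smul_eq_of_smallGL_of_mem_ballV hπ hb2 hz
    rwa [mul_smul, mul_smul, smul_inv_smul, smul_left_cancel_iff] at h

/-- If `w` is locally algebraic and trivial on the ball about an edge `τ`, then along any geodesic
ray starting with `τ` it coincides locally with elements of `U_τ`. -/
theorem exists_mem_UE_of_frame {e : ℕ} (he : 1 ≤ e) (g : GL (Fin 2) F) {w : Equiv.Perm (Vertex F)}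
    (hw : w ∈ Ghat F e)
    (hfix : ∀ z ∈ ballE e (g • stdVertex F) (g • diagGL π • stdVertex F), w z = z) (n : ℕ) :
    ∃ u ∈ UE e (g • stdVertex F) (g • diagGL π • stdVertex F),
      ∀ z ∈ ballE e (g • diagGL (π ^ n) • stdVertex F) (g • diagGL (π ^ (n + 1)) • stdVertex F),
        w z = u • z := by
  induction n with
  | zero =>
    rw [zero_add, pow_one, pow_zero, diagGL_one, one_smul]
    exact ⟨1, one_mem _, fun z hz => by rw [one_smul, hfix z hz]⟩
  | succ n ih =>
    obtain ⟨u, hu, huz⟩ := ih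
    -- `q` moves the vertex shared by the old and the new edge to the standard position.
    set q := g * diagGL (π ^ (n + 1)) with hq
    have ha : g • diagGL (π ^ (n + 1)) • stdVertex F = q • stdVertex F := smul_smul _ _ _
    have hb : g • diagGL (π ^ (n + 1 + 1)) • stdVertex F = q • diagGL π • stdVertex F := by
      rw [pow_succ, diagGL_mul, mul_smul, smul_smul]
    rw [ha] at huz
    rw [ha, hb]
    obtain ⟨h, -, hz⟩ := hw.2 _ _ (tree_adj_smul (g := q) hπ.adj_stdVertex)
    -- On the ball about the shared vertex `w` agrees with both `u` and `h`, so `u⁻¹ * h` fixes that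
    -- ball.
    obtain ⟨c, hc⟩ := hπ.exists_scalar_of_fixes_ballV he (h := q⁻¹ * u⁻¹ * h * q) fun y hy => by
      have hy' := smul_mem_ballV_iff (g := q).2 hy
      rw [mul_smul, mul_smul, mul_smul, ← hz _ (Or.inl hy'), huz _ (Or.inr hy'), inv_smul_smul,
        inv_smul_smul]
    obtain ⟨γ, b, hγ, hm, hbz⟩ := hπ.exists_eq_lowerGL_mul he hc
    have hlow : q * lowerGL γ * q⁻¹ ∈ UE e (g • stdVertex F) (g • diagGL π • stdVertex F) := by
      -- Only n of the n + 1 factors π are absorbed into the unipotent, so that the conjugate is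
      -- centred at the second vertex of the ray, an end of the initial edge.
      have h1 : q * lowerGL γ * q⁻¹ =
          (g * diagGL π) * lowerGL (((π ^ n : Fˣ) : F) * γ) * (g * diagGL π)⁻¹ := by
        rw [← diagGL_conj_lowerGL, hq, pow_succ', diagGL_mul]
        group
      rw [h1, smul_smul g]
      refine Subgroup.mem_sup_right (conj_mem_UV_smul _ (mem_UV_of_smallGL hπ
        (hπ.lowerGL_mem_smallGL he ?_)))
      rw [map_mul]
      exact (mul_le_mul' (hπ.valuation_pow_le_one n) hγ).trans (one_mul _).le
    refine ⟨u * (q * lowerGL γ * q⁻¹), mul_mem hu hlow, fun z hzE => ?_⟩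
    have hz' : q⁻¹ • z ∈ ballE e (stdVertex F) (diagGL π • stdVertex F) := by
      rw [← smul_inv_smul q z] at hzE
      exact hzE.imp smul_mem_ballV_iff.1 smul_mem_ballV_iff.1
    have h2 : (q⁻¹ * u⁻¹ * h * q) • q⁻¹ • z = lowerGL γ • q⁻¹ • z := by
      rw [← scalarGL_smul_vertex c ((q⁻¹ * u⁻¹ * h * q) • q⁻¹ • z), smul_smul, hm, mul_smul,
        hbz _ hz']
    rw [hz z hzE, mul_smul, mul_smul, mul_smul, ← h2]
    simp only [smul_smul]
    congr 1
    group

variable (π) in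
/-- The oriented edge `(a, b)` lies, pointing outwards, on a geodesic ray starting with the edge
`{x, y}`. -/
def PointsAwayFrom (x y a b : Vertex F) : Prop :=
  ∃ (g : GL (Fin 2) F) (n : ℕ),
    ((g • stdVertex F = x ∧ g • diagGL π • stdVertex F = y) ∨
      (g • stdVertex F = y ∧ g • diagGL π • stdVertex F = x)) ∧
    a = g • diagGL (π ^ n) • stdVertex F ∧ b = g • diagGL (π ^ (n + 1)) • stdVertex F

theorem pointsAwayFrom_self {x y : Vertex F} (h : (tree F).Adj x y) :
    PointsAwayFrom π x y x y ∧ PointsAwayFrom π x y y x := by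
  obtain ⟨g, h1, h2⟩ := hπ.exists_frame_edge h
  obtain ⟨g', h1', h2'⟩ := hπ.exists_frame_edge h.symm
  refine ⟨⟨g, 0, Or.inl ⟨h1, h2⟩, ?_, ?_⟩, ⟨g', 0, Or.inr ⟨h1', h2'⟩, ?_, ?_⟩⟩ <;>
    simp [diagGL_one, h1, h2, h1', h2']

/-- In the frame at `b`, a neighbour either is the previous vertex `a` or is the standard
continuation translated by an integral lower unipotent. Seen from the start of the ray, this
unipotent fixes all vertices up to `b`, so it changes the frame without changing the path so far. -/
theorem PointsAwayFrom.eq_or_pointsAwayFrom {x y a b z : Vertex F} (h : PointsAwayFrom π x y a b)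
    (hz : (tree F).Adj b z) : z = a ∨ PointsAwayFrom π x y b z := by
  obtain ⟨g, n, hxy, rfl, rfl⟩ := h
  set q := g * diagGL (π ^ (n + 1)) with hq
  have hb : g • diagGL (π ^ (n + 1)) • stdVertex F = q • stdVertex F := smul_smul _ _ _
  have h1 : (tree F).Adj (stdVertex F) (q⁻¹ • z) := by
    rw [← tree_adj_smul_iff (g := q), smul_inv_smul, ← hb]
    exact hz
  rcases hπ.eq_of_adj_stdVertex h1 with ⟨c, hc, h2⟩ | h2
  · right
    set c' := ((π ^ (n + 1) : Fˣ) : F) * c with hc'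
    have hfix : ∀ k ≤ n + 1, lowerGL c' • diagGL (π ^ k) • stdVertex F =
        diagGL (π ^ k) • stdVertex F := by
      intro k hk
      refine lowerGL_smul_diagGL_vertex ?_
      rw [hc', map_mul, Units.val_pow_eq_pow_val, Units.val_pow_eq_pow_val, map_pow, map_pow]
      exact (mul_le_mul' (pow_le_pow_of_le_one zero_le hπ.valuation_lt_one.le hk) hc).trans
        (mul_one _).le
    have hfix0 : lowerGL c' • stdVertex F = stdVertex F := by
      simpa [diagGL_one] using hfix 0 (by omega)
    have hfix1 := hfix 1 (by omega)
    rw [pow_one] at hfix1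
    refine ⟨g * lowerGL c', n + 1, ?_, ?_, ?_⟩
    · rwa [mul_smul, mul_smul, hfix0, hfix1]
    · rw [mul_smul, hfix _ le_rfl]
    · rw [← smul_inv_smul q z, h2, pow_succ π (n + 1), diagGL_mul, hc', ← diagGL_conj_lowerGL, hq]
      simp only [smul_smul]
      congr 1
      group
  · left
    rw [← smul_inv_smul q z, h2, hq, pow_succ, diagGL_mul, mul_smul, mul_smul, smul_smul (diagGL π),
      ← diagGL_mul, mul_inv_cancel]
    rw [diagGL_one, one_smul]

/-- Induction along a walk to `x`: the next vertex either continues the ray or steps back along it.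
Stepping back from the first edge leads to an end of {x, y}, where an edge pointing away exists in
either orientation. -/
theorem exists_pointsAwayFrom {x y : Vertex F} (h : (tree F).Adj x y) (b : Vertex F) :
    ∃ a, PointsAwayFrom π x y a b := by
  have key : ∀ {b c : Vertex F} (_ : (tree F).Walk b c), c = x → ∃ a, PointsAwayFrom π x y a b := by
    intro b c w hc
    induction w with
    | nil =>
      rw [hc]
      exact ⟨y, (hπ.pointsAwayFrom_self h).2⟩
    | cons hadj w ih =>
      obtain ⟨a, ha⟩ := ih hc
      rcases PointsAwayFrom.eq_or_pointsAwayFrom hπ ha hadj.symm with rfl | h'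
      · obtain ⟨g, n, hxy, h1, h2⟩ := ha
        cases n with
        | zero =>
          rw [pow_zero, diagGL_one, one_smul] at h1
          rcases hxy with ⟨h3, -⟩ | ⟨h3, -⟩
          · exact ⟨y, by rw [h1, h3]; exact (hπ.pointsAwayFrom_self h).2⟩
          · exact ⟨x, by rw [h1, h3]; exact (hπ.pointsAwayFrom_self h).1⟩
        | succ n => exact ⟨_, g, n, hxy, rfl, h1⟩
      · exact ⟨_, h'⟩
  exact key (tree_preconnected b x).some rfl

end IsUniformizer

/-- A locally algebraic automorphism of level `e` which is trivial on `Z^{(e)}(τ)` lies locally in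
`U_τ^{(e)}`. -/
theorem mem_locallyIn_UE_of_fixes_ballE {e : ℕ} (he : 1 ≤ e) {x y : Vertex F}
    (hxy : (tree F).Adj x y) {w : Equiv.Perm (Vertex F)} (hw : w ∈ Ghat F e)
    (hfix : ∀ z ∈ ballE e x y, w z = z) : w ∈ locallyIn e (UE e x y) := by
  obtain ⟨π, hπ⟩ := exists_isUniformizer (F := F)
  have key : ∀ {a b : Vertex F}, IsUniformizer.PointsAwayFrom π x y a b →
      ∃ u ∈ UE e x y, ∀ z ∈ ballE e a b, w z = u • z := by
    rintro _ _ ⟨g, n, ⟨rfl, rfl⟩ | ⟨rfl, rfl⟩, rfl, rfl⟩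
    · exact hπ.exists_mem_UE_of_frame he g hw hfix n
    · rw [UE_comm]
      rw [ballE_comm] at hfix
      exact hπ.exists_mem_UE_of_frame he g hw hfix n
  refine ⟨hw.1, fun a b hab => ?_⟩
  -- Take an outward edge ending at `a`. Then {a, b} is either that edge reversed or its outward
  -- continuation, and the orientation is irrelevant for `ballE`.
  obtain ⟨a', ha'⟩ := hπ.exists_pointsAwayFrom hxy a
  rcases IsUniformizer.PointsAwayFrom.eq_or_pointsAwayFrom hπ ha' hab with rfl | h
  · rw [ballE_comm]
    exact key ha'
  · exact key h

/-- For `n ∈ Û_σ` and `h ∈ G` there is `u ∈ U_σ` such that `n` and `u` differ by an element of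
`h Û_σ h⁻¹`. -/
theorem exists_mem_UE_conj_mem_Uhat {e : ℕ} (he : 1 ≤ e) {x y : Vertex F}
    (hxy : (tree F).Adj x y) {n : Ghat F e} (hn : n ∈ Uhat e x y) (h : GL (Fin 2) F) :
    ∃ u ∈ UE e x y, (toGhat F e h)⁻¹ * (toGhat F e u)⁻¹ * n * toGhat F e h ∈ Uhat e x y := by
  -- The edge tested is the translate by `h` of {x, y}, so the conjugated quotient is trivial around
  -- {x, y} itself.
  obtain ⟨u, hu, huz⟩ := (Subgroup.mem_subgroupOf.1 hn).2 (h • x) (h • y) (tree_adj_smul hxy)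
  refine ⟨u, hu, Subgroup.mem_subgroupOf.2
    (mem_locallyIn_UE_of_fixes_ballE he hxy (Subtype.prop _) fun z hz => ?_)⟩
  have h1 : (n : Equiv.Perm (Vertex F)) (h • z) = u • h • z :=
    huz _ (hz.imp smul_mem_ballV_iff.2 smul_mem_ballV_iff.2)
  rw [← map_inv, ← map_inv]
  change h⁻¹ • u⁻¹ • (n : Equiv.Perm (Vertex F)) (h • z) = z
  rw [h1, inv_smul_smul, inv_smul_smul]

end Propagation
end BTTree

/-! ### The proposition -/

open HeckeAction BTTree in
theorem proposition4p1
    {F : Type*} [Field F] [ValuativeRel F] [TopologicalSpace F] [IsNonarchimedeanLocalField F]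
    (p : ℕ) [Fact p.Prime] [CharP 𝓀[F] p]
    {𝔬 : Type*} [CommRing 𝔬] [IsDomain 𝔬] [IsDiscreteValuationRing 𝔬]
    [IsAdicComplete (IsLocalRing.maximalIdeal 𝔬) 𝔬] [CharP (IsLocalRing.ResidueField 𝔬) p]
    {Λ : Type*} [CommRing Λ] [IsLocalRing Λ] [IsArtinianRing Λ] [Algebra 𝔬 Λ]
    [IsLocalHom (algebraMap 𝔬 Λ)]
    (hΛ : Function.Bijective (IsLocalRing.ResidueField.map (algebraMap 𝔬 Λ)))
    (e : ℕ) (he : 1 ≤ e)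
    (xp xm : Vertex F) (hσ : (tree F).Adj xp xm)
    {V : Type*} [AddCommGroup V] [Module Λ V]
    (ρ : Representation Λ (Ghat F e) V) (hV : IsInRhat ρ xp xm) :
    (∀ (T : Hecke Λ (UE e xp xm)) (v : fixedVectors (ρ.comp (toGhat F e)) (UE e xp xm)),
      (v : V) ∈ fixedVectors ρ (Uhat e xp xm) →
        ((MulOpposite.op T • v : fixedVectors (ρ.comp (toGhat F e)) (UE e xp xm)) : V) ∈
          fixedVectors ρ (Uhat e xp xm)) ∧
    ∃ _ : Module (Hecke Λ (UE e xp xm))ᵐᵒᵖ (fixedVectors ρ (Uhat e xp xm)),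
      (∀ (a : Λ) (v : fixedVectors ρ (Uhat e xp xm)),
        MulOpposite.op (algebraMap Λ (Hecke Λ (UE e xp xm)) a) • v = a • v) ∧
      ∀ (T : Hecke Λ (UE e xp xm)) (v : fixedVectors ρ (Uhat e xp xm)),
        Submodule.inclusion (fixedVectors_le ρ xp xm) (MulOpposite.op T • v) =
          MulOpposite.op T • Submodule.inclusion (fixedVectors_le ρ xp xm) v := by
  have hmem : ∀ (T : Hecke Λ (UE e xp xm))
      (v : fixedVectors (ρ.comp (toGhat F e)) (UE e xp xm)),
      (v : V) ∈ fixedVectors ρ (Uhat e xp xm) →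
        ((MulOpposite.op T • v : fixedVectors (ρ.comp (toGhat F e)) (UE e xp xm)) : V) ∈
          fixedVectors ρ (Uhat e xp xm) := fun T v hv =>
    heckeAct_mem_fixedVectors ρ (toGhat F e)
      (fun _ hn h => exists_mem_UE_conj_mem_Uhat he hσ hn h) v hv T
  refine ⟨hmem, ?_⟩
  let : SMul (Hecke Λ (UE e xp xm))ᵐᵒᵖ (fixedVectors ρ (Uhat e xp xm)) :=
    ⟨fun T v => ⟨_, hmem T.unop (Submodule.inclusion (fixedVectors_le ρ xp xm) v) v.2⟩⟩
  have hinj := Submodule.inclusion_injective (fixedVectors_le ρ xp xm)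
  -- The module axioms are pulled back along the injective inclusion into the U-fixed vectors.
  -- Compatibility with that inclusion then holds by definition.
  let M : Module (Hecke Λ (UE e xp xm))ᵐᵒᵖ (fixedVectors ρ (Uhat e xp xm)) :=
    Function.Injective.module (Hecke Λ (UE e xp xm))ᵐᵒᵖ
      (Submodule.inclusion (fixedVectors_le ρ xp xm)).toAddMonoidHom hinj fun _ _ => rfl
  refine ⟨M, fun a v => hinj ?_, fun T v => ?_⟩
  · exact op_algebraMap_smul (ρ.comp (toGhat F e)) (UE e xp xm) a
      (Submodule.inclusion (fixedVectors_le ρ xp xm) v)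
  · rfl
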